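/- Let $d,N\in\mathbb N$, let $X\in\mathbb R^{d\times N}$ have rank $d$, and let $W_0,W_1,\dots$ be random real $d\times d$ matrices all of whose entries are i.i.d. with a law $P$ on $\mathbb R$ that has mean zero and variance one, is symmetric around zero, and is supported in $[-B,B]$. For $H\in\mathbb R^{d\times N}$ put $M(H)=\frac1N HH^\top$ and $\mathrm{BN}(H)=\operatorname{diag}(M(H))^{-1/2}H$. For $\gamma>0$ define the hidden representations by $$H_0=X,\qquad H_{\ell+1}=\mathrm{BN}(H_\ell+\gamma W_\ell H_\ell)\quad(\ell\ge 0).$$ With $\sigma_1,\dots,\sigma_d$ the singular values of $H$, let $\operatorname{rank}_\tau(H)=\#\{i:\sigma_i^2/N\ge\tau\}$. An *invariant distribution* is a probability measure $\nu$ on $\{H\in\mathbb R^{d\times N}:\text{all rows of }H\text{ have Euclidean norm }\sqrt N\}$ such that $\mathrm{BN}(H+\gamma WH)\sim\nu$ whenever $H\sim\nu$ and $W$ (a $d\times d$ matrix with i.i.d. entries of law $P$) are independent. We say that the chain $(H_\ell)$ *admits the unique invariant distribution* $\nu$ if $\nu$ is an invariant distribution and, almost surely, every invariant distribution $\rho$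 that is a weak limit point of the occupation measures $\frac1L\sum_{\ell=1}^L\delta_{H_\ell}$ ($L\to\infty$) gives $M(H)$ the same law as $\nu$ does. (This holds in particular if $\nu$ is the only invariant distribution.) The *regularity constant* of $\nu$ is $$\alpha(\nu)=\frac{\mathbb E_{H\sim\nu}\big[\operatorname{Tr}\big(\operatorname{diag}(M(H)^2)^2\big)\big]}{\mathbb E_{H\sim\nu}\big[\operatorname{Tr}\big(M(H)^3\big)\big]}.$$ **Statement.** There is an absolute constant $c>0$, and for all $d$ and $B$ there is $\gamma_0=\gamma_0(d,B)>0$, such that the following holds whenever $0<\gamma<\gamma_0$ (for all $N$, $X$, $P$ and $(W_\ell)$ as above). 1. Almost surely, $\operatorname{rank}(H_\ell)\ge c\sqrt d$ for every $\ell\ge 0$; that is, $\operatorname{rank}(H_\ell)=\Omega(\sqrt d)$. 2. Suppose that the chain admits the unique invariant distribution $\nu$, and let $\alpha=\alpha(\nu)$. If $d\ge2$, then $0<\alpha<1$. Moreover, almost surely, for every $\tau\in[0,1]$: if the sequence $(\operatorname{rank}_\tau(H_\ell))_{\ell\ge1}$ is non-increasing, then $$\operatorname{rank}_\tau(H_\ell)\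 \ge\ \sqrt{1-\alpha}\;(1-\tau)^2\sqrt d\qquad\text{for every }\ell\ge1.$$ In particular $\operatorname{rank}_\tau(H_\ell)=\Omega\big((1-\tau)^2\sqrt d\big)$, with an implied constant that depends only on an upper bound $\alpha_0<1$ for the regularity constants (for example when $\alpha$ does not increase with $d$). For $d\le 1$ the square root $\sqrt{1-\alpha}$ is read as $\sqrt{\max(1-\alpha,0)}$, and $0/0$ as $0$. -/

import Mathlib

open MeasureTheory ProbabilityTheory Filter Topology
open scoped Matrix BoundedContinuousFunction

noncomputable section

namespace BNNet

/-- Real matrices carry the product (= Borel) sigma-algebra of their entries. -/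
instance matrixMeasurableSpace {m n : Type*} : MeasurableSpace (Matrix m n ℝ) :=
  inferInstanceAs (MeasurableSpace (m → n → ℝ))

variable {d N : ℕ}

/-! ### The network -/

/-- The second moment matrix `M(H) = H Hᵀ / N`. -/
def secondMoment (H : Matrix (Fin d) (Fin N) ℝ) : Matrix (Fin d) (Fin d) ℝ :=
  (N : ℝ)⁻¹ • (H * Hᵀ)

/-- Batch normalization (scale one, shift zero): `diag(M(H))^(-1/2) H`. -/
def batchNorm (H : Matrix (Fin d) (Fin N) ℝ) : Matrix (Fin d) (Fin N) ℝ :=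
  Matrix.diagonal (fun i => (√(secondMoment H i i))⁻¹) * H

/-- One residual layer with batch normalization: `BN(H + γ W H)`. -/
def layer (γ : ℝ) (W : Matrix (Fin d) (Fin d) ℝ) (H : Matrix (Fin d) (Fin N) ℝ) :
    Matrix (Fin d) (Fin N) ℝ :=
  batchNorm (H + γ • (W * H))

/-- The hidden representations: `H₀ = X` and `H_{ℓ+1} = BN(H_ℓ + γ W_ℓ H_ℓ)`. -/
def hidden (γ : ℝ) (X : Matrix (Fin d) (Fin N) ℝ) (W : ℕ → Matrix (Fin d) (Fin d) ℝ) :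
    ℕ → Matrix (Fin d) (Fin N) ℝ
  | 0 => X
  | ℓ + 1 => layer γ (W ℓ) (hidden γ X W ℓ)

/-! ### The soft rank -/

theorem isHermitian_mul_transpose (H : Matrix (Fin d) (Fin N) ℝ) : (H * Hᵀ).IsHermitian := by
  simpa [Matrix.conjTranspose_eq_transpose_of_trivial] using
    Matrix.isHermitian_mul_conjTranspose_self H

/-- The singular values `σ₁, …, σ_d` of a `d × N` matrix `H` (with multiplicity): the square roots
of the `d` eigenvalues of `H Hᵀ`. -/
def singularValue (H : Matrix (Fin d) (Fin N) ℝ) (i : Fin d) : ℝ :=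
  √((isHermitian_mul_transpose H).eigenvalues i)

/-- The soft rank: the number of indices `i` with `σ_i² / N ≥ τ`. -/
def softRank (τ : ℝ) (H : Matrix (Fin d) (Fin N) ℝ) : ℕ :=
  (Finset.univ.filter fun i : Fin d => τ ≤ singularValue H i ^ 2 / N).card

/-! ### Random initialization -/

/-- `P` is a probability law on `ℝ` with mean zero and variance one, symmetric around zero, and
supported in `[-B, B]`. -/
structure IsWeightLaw (B : ℝ) (P : Measure ℝ) : Prop where
  isProbabilityMeasure : IsProbabilityMeasure P
  mean_zero : ∫ x, x ∂P = 0
  variance_one : ∫ x, x ^ 2 ∂P = 1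
  symmetric : P.map (fun x => -x) = P
  support : ∀ᵐ x ∂P, x ∈ Set.Icc (-B) B

/-- All entries of all weight matrices `W₀, W₁, …` are i.i.d. with law `P`. -/
structure IsIIDWeights {Ω : Type*} [MeasurableSpace Ω] (Pr : Measure Ω) (P : Measure ℝ)
    (W : ℕ → Ω → Matrix (Fin d) (Fin d) ℝ) : Prop where
  law : ∀ ℓ i j, HasLaw (fun ω => W ℓ ω i j) P Pr
  indep : iIndepFun (fun (k : ℕ × Fin d × Fin d) ω => W k.1 ω k.2.1 k.2.2) Pr

/-- The law `μ` of a single `d × d` weight matrix with i.i.d. entries of law `P`. -/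
def weightMatrixLaw (d : ℕ) (P : Measure ℝ) : Measure (Matrix (Fin d) (Fin d) ℝ) :=
  (Measure.pi fun _ : Fin d => Measure.pi fun _ : Fin d => P).map Matrix.of

/-! ### Invariant distributions -/

/-- The state space of the chain: all rows have Euclidean norm `√N`. -/
def rowNormalized (d N : ℕ) : Set (Matrix (Fin d) (Fin N) ℝ) :=
  {H | ∀ i, ∑ j, H i j ^ 2 = N}

/-- `ν` is an invariant distribution of the chain on the state space: if `H ∼ ν` and `W ∼ μ` are
independent, then `BN(H + γ W H) ∼ ν`. -/
structure IsInvariant (γ : ℝ) (P : Measure ℝ) (ν : Measure (Matrix (Fin d) (Fin N) ℝ)) :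
    Prop where
  isProbabilityMeasure : IsProbabilityMeasure ν
  mem_state : ∀ᵐ H ∂ν, H ∈ rowNormalized d N
  map_eq : ((weightMatrixLaw d P).prod ν).map (fun p => layer γ p.1 p.2) = ν

/-- `ρ` is a weak limit point, as `L → ∞`, of the occupation measures
`(1/L) ∑_{ℓ=1}^L δ_{h ℓ}` of the trajectory `h`. -/
def IsOccupationLimit (h : ℕ → Matrix (Fin d) (Fin N) ℝ)
    (ρ : Measure (Matrix (Fin d) (Fin N) ℝ)) : Prop :=
  ∃ L : ℕ → ℕ, StrictMono L ∧ ∀ g : Matrix (Fin d) (Fin N) ℝ →ᵇ ℝ,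
    Tendsto (fun n => (L n : ℝ)⁻¹ * ∑ ℓ ∈ Finset.Icc 1 (L n), g (h ℓ)) atTop (𝓝 (∫ H, g H ∂ρ))

/-- `ν` is the unique invariant distribution of the chain of hidden representations `H`.
Competing invariant distributions `ρ` are only those which the chain, started at its input, really
visits (weak limit points of its occupation measures), and they are compared through the law of
the second moment matrix `M(H)`. If `ν` is the only invariant distribution on the whole state
space, then this holds. Uniqueness on the whole state space would be too much to ask: for small
`γ` every row-normalized matrix of rank one is a fixed point of the chain, and right
multiplication by an orthogonal matrix sends invariant distributions to invariant
distributions. -/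
structure IsUniqueInvariant {Ω : Type*} [MeasurableSpace Ω] (Pr : Measure Ω) (γ : ℝ)
    (P : Measure ℝ) (H : ℕ → Ω → Matrix (Fin d) (Fin N) ℝ)
    (ν : Measure (Matrix (Fin d) (Fin N) ℝ)) : Prop where
  invariant : IsInvariant γ P ν
  unique : ∀ᵐ ω ∂Pr, ∀ ρ : Measure (Matrix (Fin d) (Fin N) ℝ), IsInvariant γ P ρ →
    IsOccupationLimit (fun ℓ => H ℓ ω) ρ → ρ.map secondMoment = ν.map secondMoment

/-- The regularity constant `E[Tr(diag(M(H)²)²)] / E[Tr(M(H)³)]`, `H ∼ ν`. -/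
def regularityConstant (ν : Measure (Matrix (Fin d) (Fin N) ℝ)) : ℝ :=
  (∫ H, (Matrix.diagonal (Matrix.diag (secondMoment H ^ 2)) ^ 2).trace ∂ν) /
    ∫ H, (secondMoment H ^ 3).trace ∂ν

end BNNet

end

noncomputable section

namespace BNNet

/-! ### Second moment matrices -/

section LinearAlgebra

variable {d N : ℕ}

/-! Write `M` for the second moment matrix, `F = Tr(M²)`, `T = Tr(M³)`, `S = Tr(diag(M²)²)`, and
`A`, `T`, `S` for the stationary means of `F`, `T`, `S`. A layer acts on `M` by conjugation with `1
+ γW` followed by conjugation with a positive diagonal matrix. For small `γ` both are invertible, so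
full rank is never lost; this is the first claim, with constant one.

The soft rank is controlled by `F`. The eigenvalues of `M` sum to `d`, and those below `τ` carry at
most `τd`, so Cauchy–Schwarz gives `((1-τ)d)² ≤ rank_τ · F` (`le_softRank_mul_frobSq`). If the soft
rank is non-increasing, averaging along the trajectory replaces `F` by its mean `A`, and it remains
to show that `√(1-α) · A ≤ d^(3/2)`.

Two drift computations to order `γ²`, uniform over the state space, carry the proof. The conditional
drift of `F` is about `γ²(2d² - 2F - 8T + 8S)` (`hasMean_coeffTwo`,
`abs_integral_nextFrobSq_sub_le`). Under an invariant law it integrates to zero, so `4(T-S)` is `d²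
- A` up to a small error, hence at most `d²` since `A ≥ d`. Spectral Cauchy–Schwarz and Jensen give
`A² ≤ dT`, so `(1-α)A² ≤ d(T-S) ≤ d³`.

That `α < 1` needs an upper bound on `A`, and stationarity alone does not give one: at rank one `S =
T = d³` and the drift vanishes. The second drift supplies it. The conditional drift of `log det M`
is at least about `γ²(2F - d - d²)` (`le_integral_logDetStep`). Since `log det M` is bounded above
on the state space, its increments telescope to a sum bounded above, and so the time average of `2F
- d - d²` cannot have a limit above a small error.

Time averages are tied to `ν` by a pathwise Krylov–Bogoliubov argument. A law of large numbers for
orthogonal increments shows that almost every trajectory has an occupation limit which is invariant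
(`isInvariant_of_occupationLimit`). By the uniqueness hypothesis this limit gives `M` the same law
as `ν`, hence the same mean of `F`. -/

theorem secondMoment_apply (H : Matrix (Fin d) (Fin N) ℝ) (i j : Fin d) :
    secondMoment H i j = (N : ℝ)⁻¹ * ∑ k, H i k * H j k := by
  simp [secondMoment, Matrix.mul_apply]

theorem secondMoment_symm (H : Matrix (Fin d) (Fin N) ℝ) (i j : Fin d) :
    secondMoment H i j = secondMoment H j i := by
  simp [secondMoment_apply, mul_comm]

theorem secondMoment_posSemidef (H : Matrix (Fin d) (Fin N) ℝ) :
    (secondMoment H).PosSemidef := by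
  have := Matrix.posSemidef_self_mul_conjTranspose H
  rw [Matrix.conjTranspose_eq_transpose_of_trivial] at this
  exact this.smul (by positivity)

theorem secondMoment_mul (A : Matrix (Fin d) (Fin d) ℝ) (H : Matrix (Fin d) (Fin N) ℝ) :
    secondMoment (A * H) = A * secondMoment H * Aᵀ := by
  simp [secondMoment, Matrix.mul_assoc, Matrix.transpose_mul]

/-- The second moment matrix of `H + γ W H` as a function of that of `H`. -/
def residualMoment (γ : ℝ) (W M : Matrix (Fin d) (Fin d) ℝ) : Matrix (Fin d) (Fin d) ℝ :=
  (1 + γ • W) * M * (1 + γ • W)ᵀ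

theorem secondMoment_residual (γ : ℝ) (W : Matrix (Fin d) (Fin d) ℝ)
    (H : Matrix (Fin d) (Fin N) ℝ) :
    secondMoment (H + γ • (W * H)) = residualMoment γ W (secondMoment H) := by
  rw [residualMoment, ← secondMoment_mul, Matrix.add_mul, Matrix.one_mul, Matrix.smul_mul]

theorem residualMoment_apply (γ : ℝ) (W M : Matrix (Fin d) (Fin d) ℝ)
    (hM : ∀ i j, M i j = M j i) (i j : Fin d) :
    residualMoment γ W M i j =
      M i j + γ * ((W * M) i j + (W * M) j i) + γ ^ 2 * (W * M * Wᵀ) i j := by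
  have hMt : Mᵀ = M := by ext a b; exact hM b a
  have h : (W * M) j i = (M * Wᵀ) i j := by
    rw [← Matrix.transpose_apply (W * M), Matrix.transpose_mul, hMt]
  rw [h, residualMoment]
  simp only [Matrix.transpose_add, Matrix.transpose_one, Matrix.transpose_smul, Matrix.add_mul,
    Matrix.mul_add, Matrix.one_mul, Matrix.mul_one, Matrix.smul_mul, Matrix.mul_smul,
    Matrix.add_apply, Matrix.smul_apply, smul_eq_mul]
  ring

theorem secondMoment_batchNorm (G : Matrix (Fin d) (Fin N) ℝ) (i j : Fin d) :
    secondMoment (batchNorm G) i j =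
      (√(secondMoment G i i))⁻¹ * secondMoment G i j * (√(secondMoment G j j))⁻¹ := by
  rw [batchNorm, secondMoment_mul]
  simp [Matrix.mul_diagonal, Matrix.diagonal_mul, Matrix.diagonal_transpose]

/-- Squaring removes the square roots of the normalization, so the expansion of `frobSq` needs only
products and inverses. -/
theorem secondMoment_batchNorm_sq (G : Matrix (Fin d) (Fin N) ℝ) (i j : Fin d) :
    secondMoment (batchNorm G) i j ^ 2 =
      secondMoment G i j ^ 2 / (secondMoment G i i * secondMoment G j j) := by
  have h := fun i : Fin d => (secondMoment_posSemidef G).diag_nonneg (i := i)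
  rw [secondMoment_batchNorm, mul_pow, mul_pow, inv_pow, inv_pow, Real.sq_sqrt (h i),
    Real.sq_sqrt (h j), div_eq_mul_inv, mul_inv]
  ring

/-- The squared Frobenius norm. -/
def frobSq (M : Matrix (Fin d) (Fin d) ℝ) : ℝ := ∑ i, ∑ j, M i j ^ 2

theorem frobSq_eq_trace {M : Matrix (Fin d) (Fin d) ℝ} (hM : ∀ i j, M i j = M j i) :
    frobSq M = (M ^ 2).trace := by
  simp only [frobSq, Matrix.trace, Matrix.diag, pow_two, Matrix.mul_apply]
  exact Finset.sum_congr rfl fun i _ => Finset.sum_congr rfl fun j _ => by rw [← hM i j]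

/-- `Tr(diag(M²)²)`. -/
def diagSqTrace (M : Matrix (Fin d) (Fin d) ℝ) : ℝ := ∑ i, ((M ^ 2) i i) ^ 2

theorem trace_diagonal_diag_sq (M : Matrix (Fin d) (Fin d) ℝ) :
    (Matrix.diagonal (Matrix.diag (M ^ 2)) ^ 2).trace = diagSqTrace M := by
  simp [Matrix.diagonal_pow, diagSqTrace]

theorem mem_rowNormalized_iff (hN : N ≠ 0) (H : Matrix (Fin d) (Fin N) ℝ) :
    H ∈ rowNormalized d N ↔ ∀ i, secondMoment H i i = 1 := by
  have : (N : ℝ) ≠ 0 := by exact_mod_cast hN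
  simp only [rowNormalized, Set.mem_ofPred_eq, secondMoment_apply, ← pow_two]
  refine forall_congr' fun i => ?_
  rw [inv_mul_eq_one₀ this, eq_comm]

theorem abs_secondMoment_le_one {H : Matrix (Fin d) (Fin N) ℝ}
    (h : ∀ i, secondMoment H i i = 1) (i j : Fin d) : |secondMoment H i j| ≤ 1 := by
  have h0 : secondMoment H i j ^ 2 ≤ secondMoment H i i * secondMoment H j j := by
    simp only [secondMoment_apply, ← pow_two]
    have := Finset.sum_mul_sq_le_sq_mul_sq Finset.univ (H i) (H j)
    have h1 : (0 : ℝ) ≤ (N : ℝ)⁻¹ ^ 2 := by positivity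
    nlinarith [mul_le_mul_of_nonneg_left this h1]
  rw [h i, h j] at h0
  exact (abs_le_one_iff_mul_self_le_one).2 (by nlinarith)

theorem trace_pow_eq_sum_eigenvalues {M : Matrix (Fin d) (Fin d) ℝ} (hM : M.IsHermitian) (k : ℕ) :
    (M ^ k).trace = ∑ i, hM.eigenvalues i ^ k := by
  conv_lhs => rw [hM.spectral_theorem]
  rw [← map_pow, Matrix.diagonal_pow, Unitary.conjStarAlgAut_apply, Matrix.trace_mul_cycle]
  simp

/-- Cauchy–Schwarz for the nonnegative eigenvalues, in the form `(λ²)² = λ · λ³`. -/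
theorem frobSq_sq_le {M : Matrix (Fin d) (Fin d) ℝ} (hM : M.PosSemidef) :
    frobSq M ^ 2 ≤ M.trace * (M ^ 3).trace := by
  have hs : ∀ i j, M i j = M j i := fun i j => by
    have := congrFun (congrFun hM.isHermitian j) i
    simpa using this
  rw [frobSq_eq_trace hs]
  conv_rhs => rw [← pow_one M]
  rw [← pow_mul]
  rw [trace_pow_eq_sum_eigenvalues hM.isHermitian, trace_pow_eq_sum_eigenvalues hM.isHermitian,
    trace_pow_eq_sum_eigenvalues hM.isHermitian]
  have h0 := hM.eigenvalues_nonneg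
  refine Finset.sum_sq_le_sum_mul_sum_of_sq_le_mul _ (fun i _ => ?_) (fun i _ => ?_)
    (fun i _ => ?_)
  · simpa using h0 i
  · exact pow_nonneg (h0 i) _
  · exact le_of_eq (by ring)

theorem le_frobSq {M : Matrix (Fin d) (Fin d) ℝ} (h : ∀ i, M i i = 1) : (d : ℝ) ≤ frobSq M := by
  calc (d : ℝ) = ∑ i : Fin d, M i i ^ 2 := by simp [h]
    _ ≤ frobSq M := Finset.sum_le_sum fun i _ =>
      Finset.single_le_sum (f := fun j => M i j ^ 2) (fun j _ => sq_nonneg _) (Finset.mem_univ i)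

theorem le_diagSqTrace {M : Matrix (Fin d) (Fin d) ℝ} (hs : ∀ i j, M i j = M j i)
    (h : ∀ i, M i i = 1) : (d : ℝ) ≤ diagSqTrace M := by
  have h1 : ∀ i, 1 ≤ (M ^ 2) i i := fun i => by
    rw [pow_two, Matrix.mul_apply]
    calc (1 : ℝ) = M i i * M i i := by simp [h]
      _ ≤ _ := Finset.single_le_sum (f := fun j => M i j * M j i)
        (fun j _ => by rw [hs j i]; exact mul_self_nonneg _) (Finset.mem_univ i)
  calc (d : ℝ) = ∑ i : Fin d, 1 := by simp
    _ ≤ diagSqTrace M := Finset.sum_le_sum fun i _ => one_le_pow₀ (h1 i)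

/-- The soft rank bounds the Frobenius norm of a normalized second moment matrix from below. -/
theorem le_softRank_mul_frobSq (hN : N ≠ 0) {H : Matrix (Fin d) (Fin N) ℝ}
    (hH : H ∈ rowNormalized d N) {τ : ℝ} (hτ : τ ∈ Set.Icc (0 : ℝ) 1) :
    ((1 - τ) * d) ^ 2 ≤ softRank τ H * frobSq (secondMoment H) := by
  have hN' : (0 : ℝ) < N := by exact_mod_cast Nat.pos_of_ne_zero hN
  set hh := isHermitian_mul_transpose H
  have hps : (H * Hᵀ).PosSemidef := by
    have := Matrix.posSemidef_self_mul_conjTranspose H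
    rwa [Matrix.conjTranspose_eq_transpose_of_trivial] at this
  set e : Fin d → ℝ := fun i => (N : ℝ)⁻¹ * hh.eigenvalues i with he
  have hsv : ∀ i, singularValue H i ^ 2 / N = e i := fun i => by
    rw [singularValue, Real.sq_sqrt (hps.eigenvalues_nonneg i), he, div_eq_inv_mul]
  have h1 : ∑ i, e i = d := by
    have h := trace_pow_eq_sum_eigenvalues hh 1
    simp only [pow_one] at h
    rw [he, ← Finset.mul_sum, ← h]
    have h2 : (secondMoment H).trace = d := by
      simp [Matrix.trace, (mem_rowNormalized_iff hN H).1 hH]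
    rw [← h2, secondMoment, Matrix.trace_smul, smul_eq_mul]
  have h2 : ∑ i, e i ^ 2 = frobSq (secondMoment H) := by
    rw [frobSq_eq_trace (secondMoment_symm H), secondMoment, smul_pow, Matrix.trace_smul,
      trace_pow_eq_sum_eigenvalues hh 2]
    simp only [he, mul_pow, ← Finset.mul_sum, smul_eq_mul]
  set s := Finset.univ.filter fun i : Fin d => τ ≤ singularValue H i ^ 2 / N
  -- The rescaled eigenvalues sum to `d`, and at most `d` of them lie below `τ`.
  have hlow : (1 - τ) * d ≤ ∑ i ∈ s, e i := by
    have hsplit := Finset.sum_filter_add_sum_filter_not Finset.univ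
      (fun i : Fin d => τ ≤ singularValue H i ^ 2 / N) e
    have hsmall : ∑ i ∈ Finset.univ.filter (fun i : Fin d => ¬ τ ≤ singularValue H i ^ 2 / N), e i
        ≤ d * τ := by
      refine (Finset.sum_le_card_nsmul _ _ τ fun i hi => ?_).trans ?_
      · have := (Finset.mem_filter.1 hi).2
        rw [hsv] at this
        exact (not_le.1 this).le
      · rw [nsmul_eq_mul]
        have : ((Finset.univ.filter
            (fun i : Fin d => ¬ τ ≤ singularValue H i ^ 2 / N)).card : ℝ) ≤ d := by
          exact_mod_cast (Finset.card_le_univ _).trans_eq (Fintype.card_fin d)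
        exact mul_le_mul_of_nonneg_right this hτ.1
    linarith
  have hcs : (∑ i ∈ s, e i) ^ 2 ≤ s.card * ∑ i ∈ s, e i ^ 2 := sq_sum_le_card_mul_sum_sq
  have h0 : 0 ≤ (1 - τ) * d := mul_nonneg (by linarith [hτ.2]) (by positivity)
  calc ((1 - τ) * d) ^ 2 ≤ (∑ i ∈ s, e i) ^ 2 := pow_le_pow_left₀ h0 hlow 2
    _ ≤ s.card * ∑ i ∈ s, e i ^ 2 := hcs
    _ ≤ s.card * ∑ i, e i ^ 2 := by
      gcongr
      exact s.subset_univ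
    _ = softRank τ H * frobSq (secondMoment H) := by rw [h2]; rfl

end LinearAlgebra

end BNNet

end

noncomputable section

namespace BNNet

/-! ### Second order expansions -/

section Expansion

open Asymptotics

variable {α : Type*} {l : Filter α} {g f h f₀ f₁ f₂ h₀ h₁ h₂ : α → ℝ}

/-- `f = f₀ + g f₁ + g² f₂ + O(g³)` along `l`, with bounded coefficients. -/
structure HasExpansion (l : Filter α) (g f f₀ f₁ f₂ : α → ℝ) : Prop where
  bdd₀ : f₀ =O[l] (1 : α → ℝ)
  bdd₁ : f₁ =O[l] (1 : α → ℝ)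
  bdd₂ : f₂ =O[l] (1 : α → ℝ)
  rem : (fun x => f x - (f₀ x + g x * f₁ x + g x ^ 2 * f₂ x)) =O[l] fun x => g x ^ 3

theorem isBigO_one_mul (hf : f =O[l] (1 : α → ℝ)) (hh : h =O[l] (1 : α → ℝ)) :
    (fun x => f x * h x) =O[l] (1 : α → ℝ) := by
  exact (hf.mul hh).congr_right fun x => by simp

theorem isBigO_one_pow (hf : f =O[l] (1 : α → ℝ)) (n : ℕ) :
    (fun x => f x ^ n) =O[l] (1 : α → ℝ) := by
  exact (hf.pow n).congr_right fun x => by simp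

theorem isBigO_mul_one {k : α → ℝ} (hf : f =O[l] k) (hh : h =O[l] (1 : α → ℝ)) :
    (fun x => f x * h x) =O[l] k := by
  simpa using hf.mul hh

theorem isBigO_one_of_tendsto_zero (hg : Tendsto g l (𝓝 0)) : g =O[l] (1 : α → ℝ) :=
  hg.isBigO_one ℝ

namespace HasExpansion

theorem poly_isBigO_one (hg : Tendsto g l (𝓝 0)) (hf : HasExpansion l g f f₀ f₁ f₂) :
    (fun x => f₀ x + g x * f₁ x + g x ^ 2 * f₂ x) =O[l] (1 : α → ℝ) := by
  have hg1 := isBigO_one_of_tendsto_zero hg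
  exact (hf.bdd₀.add (isBigO_one_mul hg1 hf.bdd₁)).add
    (isBigO_one_mul (isBigO_one_pow hg1 2) hf.bdd₂)

theorem isBigO_one (hg : Tendsto g l (𝓝 0)) (hf : HasExpansion l g f f₀ f₁ f₂) :
    f =O[l] (1 : α → ℝ) := by
  have h1 := hf.rem.trans (isBigO_one_pow (isBigO_one_of_tendsto_zero hg) 3)
  simpa using h1.add (hf.poly_isBigO_one hg)

theorem of_eq (h0 : f₀ =O[l] (1 : α → ℝ)) (h1 : f₁ =O[l] (1 : α → ℝ))
    (h2 : f₂ =O[l] (1 : α → ℝ)) (h : ∀ᶠ x in l, f x = f₀ x + g x * f₁ x + g x ^ 2 * f₂ x) :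
    HasExpansion l g f f₀ f₁ f₂ := by
  refine ⟨h0, h1, h2, ?_⟩
  refine (isBigO_zero _ l).congr' ?_ .rfl
  filter_upwards [h] with x hx
  simp [hx]

theorem mul (hg : Tendsto g l (𝓝 0)) (hf : HasExpansion l g f f₀ f₁ f₂)
    (hh : HasExpansion l g h h₀ h₁ h₂) :
    HasExpansion l g (fun x => f x * h x) (fun x => f₀ x * h₀ x)
      (fun x => f₀ x * h₁ x + f₁ x * h₀ x)
      (fun x => f₀ x * h₂ x + f₁ x * h₁ x + f₂ x * h₀ x) := by
  have hg1 := isBigO_one_of_tendsto_zero hg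
  refine ⟨isBigO_one_mul hf.bdd₀ hh.bdd₀,
    (isBigO_one_mul hf.bdd₀ hh.bdd₁).add (isBigO_one_mul hf.bdd₁ hh.bdd₀),
    ((isBigO_one_mul hf.bdd₀ hh.bdd₂).add (isBigO_one_mul hf.bdd₁ hh.bdd₁)).add
      (isBigO_one_mul hf.bdd₂ hh.bdd₀), ?_⟩
  have e1 := isBigO_mul_one hf.rem (hh.isBigO_one hg)
  have e2 := isBigO_mul_one hh.rem (hf.poly_isBigO_one hg)
  have e3 : (fun x => g x ^ 3 * (f₁ x * h₂ x + f₂ x * h₁ x + g x * (f₂ x * h₂ x)))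
      =O[l] fun x => g x ^ 3 :=
    isBigO_mul_one (isBigO_refl _ l)
      (((isBigO_one_mul hf.bdd₁ hh.bdd₂).add (isBigO_one_mul hf.bdd₂ hh.bdd₁)).add
        (isBigO_one_mul hg1 (isBigO_one_mul hf.bdd₂ hh.bdd₂)))
  refine ((e1.add e2).add e3).congr_left fun x => ?_
  ring

theorem congr_coeff {f₀' f₁' f₂' : α → ℝ} (hf : HasExpansion l g f f₀ f₁ f₂)
    (e0 : ∀ᶠ x in l, f₀ x = f₀' x) (e1 : ∀ᶠ x in l, f₁ x = f₁' x)
    (e2 : ∀ᶠ x in l, f₂ x = f₂' x) : HasExpansion l g f f₀' f₁' f₂' := by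
  refine ⟨hf.bdd₀.congr' e0 .rfl, hf.bdd₁.congr' e1 .rfl, hf.bdd₂.congr' e2 .rfl,
    hf.rem.congr' ?_ .rfl⟩
  filter_upwards [e0, e1, e2] with x h0 h1 h2
  rw [h0, h1, h2]

theorem tendsto_one (hg : Tendsto g l (𝓝 0)) (hf : HasExpansion l g f (fun _ => 1) f₁ f₂) :
    Tendsto f l (𝓝 1) := by
  have hg1 := isBigO_one_of_tendsto_zero hg
  have h1 : (fun x => f x - 1) =O[l] g := by
    have e1 : (fun x => g x ^ 3) =O[l] g :=
      (isBigO_mul_one (isBigO_refl g l) (isBigO_one_pow hg1 2)).congr_left fun x => by ring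
    have e2 : (fun x => g x * (f₁ x + g x * f₂ x)) =O[l] g :=
      isBigO_mul_one (isBigO_refl g l) (hf.bdd₁.add (isBigO_one_mul hg1 hf.bdd₂))
    refine ((hf.rem.trans e1).add e2).congr_left fun x => ?_
    ring
  have h2 := h1.trans_tendsto hg
  simpa using h2.add_const 1

/-- The product of `f` with the candidate polynomial is `1 + O(g³)`. Multiplying by the bounded
function `1 / f` isolates the remainder of the inverse. -/
theorem inv (hg : Tendsto g l (𝓝 0)) (hf : HasExpansion l g f (fun _ => 1) f₁ f₂) :
    HasExpansion l g (fun x => (f x)⁻¹) (fun _ => 1) (fun x => -f₁ x)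
      (fun x => f₁ x ^ 2 - f₂ x) := by
  have b1 : (fun x => -f₁ x) =O[l] (1 : α → ℝ) := hf.bdd₁.neg_left
  have b2 : (fun x => f₁ x ^ 2 - f₂ x) =O[l] (1 : α → ℝ) :=
    (isBigO_one_pow hf.bdd₁ 2).sub hf.bdd₂
  have hp : HasExpansion l g
      (fun x => 1 + g x * (-f₁ x) + g x ^ 2 * (f₁ x ^ 2 - f₂ x)) (fun _ => 1)
      (fun x => -f₁ x) (fun x => f₁ x ^ 2 - f₂ x) :=
    of_eq hf.bdd₀ b1 b2 (Eventually.of_forall fun x => rfl)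
  have hm := (hp.mul hg hf).rem
  have ht := hf.tendsto_one hg
  have hi : (fun x => (f x)⁻¹) =O[l] (1 : α → ℝ) :=
    (ht.inv₀ one_ne_zero).isBigO_one ℝ
  refine ⟨hf.bdd₀, b1, b2, ?_⟩
  refine (isBigO_mul_one hm hi).neg_left.congr' ?_ .rfl
  filter_upwards [ht.eventually_ne one_ne_zero] with x hx
  field_simp
  ring

theorem log (hg : Tendsto g l (𝓝 0)) (hf : HasExpansion l g f (fun _ => 1) f₁ f₂) :
    HasExpansion l g (fun x => Real.log (f x)) (fun _ => 0) f₁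
      (fun x => f₂ x - f₁ x ^ 2 / 2) := by
  have hg1 := isBigO_one_of_tendsto_zero hg
  have hx : HasExpansion l g (fun x => f x - 1) (fun _ => 0) f₁ f₂ := by
    refine ⟨isBigO_zero _ _, hf.bdd₁, hf.bdd₂, hf.rem.congr_left fun x => ?_⟩
    ring
  have hxg : (fun x => f x - 1) =O[l] g := by
    have e1 : (fun x => g x ^ 3) =O[l] g :=
      (isBigO_mul_one (isBigO_refl g l) (isBigO_one_pow hg1 2)).congr_left fun x => by ring
    have e2 : (fun x => g x * (f₁ x + g x * f₂ x)) =O[l] g :=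
      isBigO_mul_one (isBigO_refl g l) (hf.bdd₁.add (isBigO_one_mul hg1 hf.bdd₂))
    refine ((hf.rem.trans e1).add e2).congr_left fun x => ?_
    ring
  have hx2 := (hx.mul hg hx).rem
  -- The second-order Taylor bound for `log (1 - x)` is used at `x = -(f - 1)`. Its factor `1 / (1 -
  -- |x|)` is at most `2` once `|x| < 1/2`.
  have hlog : (fun x => Real.log (f x) - ((f x - 1) - (f x - 1) ^ 2 / 2)) =O[l]
      fun x => g x ^ 3 := by
    have ht : Tendsto (fun x => f x - 1) l (𝓝 0) := hxg.trans_tendsto hg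
    refine IsBigO.trans (IsBigO.of_bound 2 ?_) (hxg.pow 3)
    have hs : ∀ᶠ x in l, |f x - 1| < 1 / 2 := by
      have := ht.eventually (Metric.ball_mem_nhds (0 : ℝ) (ε := 1 / 2) (by norm_num))
      filter_upwards [this] with x hx
      simpa [Real.dist_eq] using hx
    filter_upwards [hs] with x hx
    have h := Real.abs_log_sub_add_sum_range_le (x := -(f x - 1)) (by rw [abs_neg]; linarith) 2
    simp only [Finset.sum_range_succ, Finset.sum_range_zero, abs_neg] at h
    rw [show 1 - -(f x - 1) = f x by ring] at h
    rw [Real.norm_eq_abs, Real.norm_eq_abs, abs_pow]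
    have e : Real.log (f x) - ((f x - 1) - (f x - 1) ^ 2 / 2) =
        0 + (-(f x - 1)) ^ (0 + 1) / ((0 : ℕ) + 1) + (-(f x - 1)) ^ (1 + 1) / ((1 : ℕ) + 1) +
          Real.log (f x) := by push_cast; ring
    rw [e]
    refine h.trans ?_
    rw [div_le_iff₀ (by linarith)]
    have h0 : 0 ≤ |f x - 1| ^ (2 + 1) := by positivity
    rw [show (2 : ℕ) + 1 = 3 from rfl] at h0 ⊢
    nlinarith
  refine ⟨isBigO_zero _ _, hf.bdd₁,
    hf.bdd₂.sub ((isBigO_one_pow hf.bdd₁ 2).const_mul_left (1 / 2) |>.congr_left fun x => by ring),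
    ?_⟩
  refine ((hlog.add hx.rem).add (hx2.const_mul_left (-1 / 2))).congr_left fun x => ?_
  ring

theorem sum {ι : Type*} (s : Finset ι) {F F₀ F₁ F₂ : ι → α → ℝ}
    (hF : ∀ i ∈ s, HasExpansion l g (F i) (F₀ i) (F₁ i) (F₂ i)) :
    HasExpansion l g (fun x => ∑ i ∈ s, F i x) (fun x => ∑ i ∈ s, F₀ i x)
      (fun x => ∑ i ∈ s, F₁ i x) (fun x => ∑ i ∈ s, F₂ i x) := by
  refine ⟨IsBigO.fun_sum fun i hi => (hF i hi).bdd₀, IsBigO.fun_sum fun i hi => (hF i hi).bdd₁,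
    IsBigO.fun_sum fun i hi => (hF i hi).bdd₂, ?_⟩
  refine (IsBigO.fun_sum fun i hi => (hF i hi).rem).congr_left fun x => ?_
  simp only [Finset.sum_sub_distrib, Finset.sum_add_distrib, Finset.mul_sum]

end HasExpansion

end Expansion

/-! ### Expansions of one layer, uniform in the moment matrix and the weights -/

section Pointwise

open Asymptotics

variable {d : ℕ}

/-- Symmetric matrices with unit diagonal and entries in `[-1, 1]`, paired with weight matrices with
entries in `[-B, B]`. -/
def admissible (d : ℕ) (B : ℝ) : Set (Matrix (Fin d) (Fin d) ℝ × Matrix (Fin d) (Fin d) ℝ) :=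
  {p | (∀ i j, p.1 i j = p.1 j i) ∧ (∀ i, p.1 i i = 1) ∧ (∀ i j, |p.1 i j| ≤ 1) ∧
    ∀ i j, |p.2 i j| ≤ B}

/-- Triples of a step size, a second moment matrix and a weight matrix. -/
abbrev StepParam (d : ℕ) := ℝ × Matrix (Fin d) (Fin d) ℝ × Matrix (Fin d) (Fin d) ℝ

/-- Small `γ > 0`, uniformly over the admissible pairs. -/
def smallStep (d : ℕ) (B : ℝ) :
    Filter (StepParam d) :=
  𝓝[>] 0 ×ˢ 𝓟 (admissible d B)

theorem tendsto_fst_smallStep (B : ℝ) : Tendsto Prod.fst (smallStep d B) (𝓝 0) :=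
  tendsto_fst.mono_right nhdsWithin_le_nhds

theorem eventually_admissible (B : ℝ) : ∀ᶠ x in smallStep d B, x.2 ∈ admissible d B :=
  tendsto_snd.eventually (mem_principal_self _)

/-- The principal filter in `smallStep` encodes uniformity over admissible pairs; this is why the
threshold depends only on `d` and `B`. -/
theorem exists_forall_of_eventually_smallStep {B : ℝ}
    {p : StepParam d → Prop}
    (h : ∀ᶠ x in smallStep d B, p x) :
    ∃ γ₀ : ℝ, 0 < γ₀ ∧ ∀ γ, 0 < γ → γ < γ₀ → ∀ M W, (M, W) ∈ admissible d B → p (γ, M, W) := by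
  rw [smallStep, eventually_prod_principal_iff] at h
  obtain ⟨γ₀, h0, h1⟩ := mem_nhdsGT_iff_exists_Ioo_subset.1 h
  exact ⟨γ₀, h0, fun γ hγ hγ' M W hMW => h1 ⟨hγ, hγ'⟩ (M, W) hMW⟩

theorem isBigO_entry (B : ℝ) (i j : Fin d) :
    (fun x => x.2.1 i j) =O[smallStep d B] (1 : StepParam d → ℝ) := by
  refine IsBigO.of_bound 1 ?_
  filter_upwards [eventually_admissible B] with x hx
  simpa using hx.2.2.1 i j

theorem isBigO_weight (B : ℝ) (i j : Fin d) :
    (fun x => x.2.2 i j) =O[smallStep d B] (1 : StepParam d → ℝ) := by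
  refine IsBigO.of_bound B ?_
  filter_upwards [eventually_admissible B] with x hx
  simpa using hx.2.2.2 i j

theorem isBigO_weight_mul (B : ℝ) (i j : Fin d) :
    (fun x => (x.2.2 * x.2.1) i j) =O[smallStep d B] (1 : StepParam d → ℝ) := by
  simp only [Matrix.mul_apply]
  exact IsBigO.fun_sum fun k _ => isBigO_one_mul (isBigO_weight B i k) (isBigO_entry B k j)

theorem isBigO_weight_mul_mul (B : ℝ) (i j : Fin d) :
    (fun x => (x.2.2 * x.2.1 * x.2.2ᵀ) i j) =O[smallStep d B] (1 : StepParam d → ℝ) := by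
  simp only [Matrix.mul_apply (M := _ * _), Matrix.transpose_apply]
  exact IsBigO.fun_sum fun k _ => isBigO_one_mul (isBigO_weight_mul B i k) (isBigO_weight B j k)

theorem hasExpansion_residualMoment (B : ℝ) (i j : Fin d) :
    HasExpansion (smallStep d B) Prod.fst (fun x => residualMoment x.1 x.2.2 x.2.1 i j)
      (fun x => x.2.1 i j) (fun x => (x.2.2 * x.2.1) i j + (x.2.2 * x.2.1) j i)
      (fun x => (x.2.2 * x.2.1 * x.2.2ᵀ) i j) := by
  refine HasExpansion.of_eq (isBigO_entry B i j)
    ((isBigO_weight_mul B i j).add (isBigO_weight_mul B j i)) (isBigO_weight_mul_mul B i j) ?_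
  filter_upwards [eventually_admissible B] with x hx
  exact residualMoment_apply _ _ _ hx.1 i j

theorem hasExpansion_residualMoment_diag (B : ℝ) (i : Fin d) :
    HasExpansion (smallStep d B) Prod.fst (fun x => residualMoment x.1 x.2.2 x.2.1 i i)
      (fun _ => 1) (fun x => 2 * (x.2.2 * x.2.1) i i)
      (fun x => (x.2.2 * x.2.1 * x.2.2ᵀ) i i) := by
  refine (hasExpansion_residualMoment B i i).congr_coeff ?_ ?_ (.of_forall fun x => rfl)
  · filter_upwards [eventually_admissible B] with x hx using hx.2.1 i
  · exact .of_forall fun x => by ring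

/-- First order coefficient of the squared entries of the normalized residual moment. -/
def coeffOne (M W : Matrix (Fin d) (Fin d) ℝ) (i j : Fin d) : ℝ :=
  2 * M i j * ((W * M) i j + (W * M) j i) - 2 * M i j ^ 2 * ((W * M) i i + (W * M) j j)

/-- Second order coefficient of the squared entries of the normalized residual moment. -/
def coeffTwo (M W : Matrix (Fin d) (Fin d) ℝ) (i j : Fin d) : ℝ :=
  ((W * M) i j + (W * M) j i) ^ 2 + 2 * M i j * (W * M * Wᵀ) i j
    + M i j ^ 2 * (4 * (W * M) i i ^ 2 + 4 * (W * M) j j ^ 2 + 4 * ((W * M) i i * (W * M) j j)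
      - (W * M * Wᵀ) i i - (W * M * Wᵀ) j j)
    - 4 * M i j * (((W * M) i j + (W * M) j i) * ((W * M) i i + (W * M) j j))

/-- The squared Frobenius norm of the normalized residual moment. -/
def nextFrobSq (γ : ℝ) (W M : Matrix (Fin d) (Fin d) ℝ) : ℝ :=
  ∑ i, ∑ j, residualMoment γ W M i j ^ 2 /
    (residualMoment γ W M i i * residualMoment γ W M j j)

/-- Each summand is a squared entry times two inverses of diagonal entries whose leading term is
one, so the calculus of expansions applies entry by entry. -/
theorem hasExpansion_nextFrobSq (d : ℕ) (B : ℝ) :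
    HasExpansion (smallStep d B) Prod.fst (fun x => nextFrobSq x.1 x.2.2 x.2.1)
      (fun x => frobSq x.2.1) (fun x => ∑ i, ∑ j, coeffOne x.2.1 x.2.2 i j)
      (fun x => ∑ i, ∑ j, coeffTwo x.2.1 x.2.2 i j) := by
  refine HasExpansion.sum _ fun i _ => HasExpansion.sum _ fun j _ => ?_
  have hg := tendsto_fst_smallStep (d := d) B
  have h1 := (hasExpansion_residualMoment B i j).mul hg (hasExpansion_residualMoment B i j)
  have h2 := ((hasExpansion_residualMoment_diag B i).inv hg).mul hg
    ((hasExpansion_residualMoment_diag B j).inv hg)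
  have h3 := h1.mul hg h2
  have e : (fun x : StepParam d =>
      residualMoment x.1 x.2.2 x.2.1 i j ^ 2 /
        (residualMoment x.1 x.2.2 x.2.1 i i * residualMoment x.1 x.2.2 x.2.1 j j)) =
      fun x => residualMoment x.1 x.2.2 x.2.1 i j * residualMoment x.1 x.2.2 x.2.1 i j *
        ((residualMoment x.1 x.2.2 x.2.1 i i)⁻¹ * (residualMoment x.1 x.2.2 x.2.1 j j)⁻¹) := by
    funext x
    rw [div_eq_mul_inv, mul_inv, pow_two]
  rw [e]
  refine h3.congr_coeff (.of_forall fun x => ?_) (.of_forall fun x => ?_)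
    (.of_forall fun x => ?_)
  · ring
  · simp only [coeffOne]; ring
  · simp only [coeffTwo]; ring

/-- Turns the cubic remainders into `ε γ²` for arbitrary `ε`, the scale on which the drifts live. -/
theorem cube_isLittleO_sq (B : ℝ) :
    (fun x => x.1 ^ 3 : StepParam d → ℝ)
      =o[smallStep d B] fun x => x.1 ^ 2 := by
  have h : (fun x : StepParam d => x.1 ^ 2 * x.1)
      =o[smallStep d B] fun x => x.1 ^ 2 * 1 :=
    (isBigO_refl _ _).mul_isLittleO
      ((isLittleO_one_iff ℝ).2 (tendsto_fst_smallStep B))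
  refine h.congr (fun x => by ring) (fun x => by ring)

theorem abs_nextFrobSq_sub_le (d : ℕ) (B : ℝ) {ε : ℝ} (hε : 0 < ε) :
    ∃ γ₀ : ℝ, 0 < γ₀ ∧ ∀ γ, 0 < γ → γ < γ₀ → ∀ M W : Matrix (Fin d) (Fin d) ℝ,
      (M, W) ∈ admissible d B →
      |nextFrobSq γ W M - (frobSq M + γ * (∑ i, ∑ j, coeffOne M W i j)
        + γ ^ 2 * ∑ i, ∑ j, coeffTwo M W i j)| ≤ ε * γ ^ 2 := by
  have h := ((hasExpansion_nextFrobSq d B).rem.trans_isLittleO (cube_isLittleO_sq B)).bound hε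
  obtain ⟨γ₀, h0, h1⟩ := exists_forall_of_eventually_smallStep h
  refine ⟨γ₀, h0, fun γ hγ hγ' M W hMW => ?_⟩
  simpa using h1 γ hγ hγ' M W hMW

theorem abs_sum_log_residualMoment_sub_le (d : ℕ) (B : ℝ) {ε : ℝ} (hε : 0 < ε) :
    ∃ γ₀ : ℝ, 0 < γ₀ ∧ ∀ γ, 0 < γ → γ < γ₀ → ∀ M W : Matrix (Fin d) (Fin d) ℝ,
      (M, W) ∈ admissible d B →
      |∑ i, Real.log (residualMoment γ W M i i) - (γ * (∑ i, 2 * (W * M) i i)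
        + γ ^ 2 * ∑ i, ((W * M * Wᵀ) i i - 2 * (W * M) i i ^ 2))| ≤ ε * γ ^ 2 := by
  have hs := HasExpansion.sum Finset.univ fun i (_ : i ∈ Finset.univ) =>
    (hasExpansion_residualMoment_diag (d := d) B i).log (tendsto_fst_smallStep B)
  have h := (hs.rem.trans_isLittleO (cube_isLittleO_sq B)).bound hε
  obtain ⟨γ₀, h0, h1⟩ := exists_forall_of_eventually_smallStep h
  refine ⟨γ₀, h0, fun γ hγ hγ' M W hMW => ?_⟩
  have := h1 γ hγ hγ' M W hMW
  simp only [Finset.sum_const_zero, zero_add, Real.norm_eq_abs, abs_pow, sq_abs] at this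
  convert this using 6
  ring

/-- The derivative of the determinant at the identity is the trace. Differentiability is clear from
the Leibniz formula, so the derivative can be identified along lines. The argument is an array of
entries because such arrays carry a norm. -/
theorem det_one_add_sub_isLittleO :
    (fun A : Fin d → Fin d → ℝ => (1 + Matrix.of A).det - (1 + (Matrix.of A).trace))
      =o[𝓝 0] fun A => A := by
  have hdiff : Differentiable ℝ fun A : Fin d → Fin d → ℝ => (1 + Matrix.of A).det := by
    simp only [Matrix.det_apply, Matrix.add_apply, Matrix.of_apply]
    fun_prop
  have h0 := (hdiff 0).hasFDerivAt
  set L := fderiv ℝ (fun A : Fin d → Fin d → ℝ => (1 + Matrix.of A).det) 0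
  have hL : ∀ A : Fin d → Fin d → ℝ, L A = (Matrix.of A).trace := fun A => by
    have h1 : HasDerivAt (fun r : ℝ => (1 + Matrix.of (r • A)).det) (L A) 0 := by
      have h2 : HasDerivAt (fun r : ℝ => r • A) A 0 := by
        simpa using (hasDerivAt_id (0 : ℝ)).smul_const A
      have h3 : HasFDerivAt (fun A : Fin d → Fin d → ℝ => (1 + Matrix.of A).det) L
          ((0 : ℝ) • A) := by simpa using h0
      exact h3.comp_hasDerivAt 0 h2
    -- Along a line the determinant is a polynomial in `r` whose linear coefficient is the trace;
    -- the rest is divisible by `r²`.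
    have h4 : (fun r : ℝ => (1 + Matrix.of (r • A)).det) = fun r =>
        1 + (Matrix.of A).trace * r +
          (Matrix.det (1 + (Polynomial.X : Polynomial ℝ) •
            (Matrix.of A).map Polynomial.C)).divX.divX.eval r * r ^ 2 := by
      funext r
      rw [← Matrix.det_one_add_smul]
      rfl
    rw [h4] at h1
    set q := (Matrix.det (1 + (Polynomial.X : Polynomial ℝ) •
            (Matrix.of A).map Polynomial.C)).divX.divX
    have h5 : HasDerivAt (fun r : ℝ => 1 + (Matrix.of A).trace * r + q.eval r * r ^ 2)
        ((Matrix.of A).trace) 0 := by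
      have := (((hasDerivAt_id (0 : ℝ)).const_mul (Matrix.of A).trace).const_add 1).add
        ((q.hasDerivAt 0).mul ((hasDerivAt_id (0 : ℝ)).pow 2))
      refine (this.congr_deriv ?_).congr_of_eventuallyEq (.of_forall fun r => ?_)
      · simp
      · simp
    exact h1.unique h5
  have := hasFDerivAt_iff_isLittleO_nhds_zero.1 h0
  refine this.congr_left fun A => ?_
  simp only [zero_add, hL]
  simp [sub_sub]

end Pointwise

end BNNet

end

noncomputable section

namespace BNNet

/-! ### The determinant of the residual map and bounds for one step -/

section Determinant

open Asymptotics

variable {d : ℕ}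

theorem tendsto_det_residual (d : ℕ) (B : ℝ) :
    Tendsto (fun x : StepParam d => (1 + x.1 • x.2.2).det) (smallStep d B) (𝓝 1) := by
  have hc : Continuous fun A : Matrix (Fin d) (Fin d) ℝ => (1 + A).det := by fun_prop
  have ht : Tendsto (fun x : StepParam d => x.1 • x.2.2) (smallStep d B) (𝓝 0) := by
    refine tendsto_pi_nhds.2 fun i => tendsto_pi_nhds.2 fun j => ?_
    have h1 : (fun x : StepParam d => x.1 * x.2.2 i j) =O[smallStep d B] fun x => x.1 :=
      isBigO_mul_one (isBigO_refl _ _) (isBigO_weight B i j)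
    exact h1.trans_tendsto (tendsto_fst_smallStep B)
  have := (hc.tendsto 0).comp ht
  simpa [Function.comp_def] using this

/-- Here the perturbation of the identity is itself of order `γ²`, so first-order expansions of the
determinant and of the logarithm suffice. -/
theorem log_det_one_sub_isLittleO (d : ℕ) (B : ℝ) :
    (fun x : StepParam d => Real.log (1 - x.1 ^ 2 • (x.2.2 * x.2.2)).det +
      x.1 ^ 2 * (x.2.2 * x.2.2).trace) =o[smallStep d B] fun x => x.1 ^ 2 := by
  set A : StepParam d → Fin d → Fin d → ℝ := fun x i j => -(x.1 ^ 2 * (x.2.2 * x.2.2) i j) with hA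
  have hAO : A =O[smallStep d B] fun x => x.1 ^ 2 := by
    rw [isBigO_pi]
    intro i
    rw [isBigO_pi]
    intro j
    refine (isBigO_mul_one (isBigO_refl _ _) ?_).neg_left
    simp only [Matrix.mul_apply]
    exact IsBigO.fun_sum fun k _ => isBigO_one_mul (isBigO_weight B i k) (isBigO_weight B k j)
  have hsq : Tendsto (fun x : StepParam d => x.1 ^ 2) (smallStep d B) (𝓝 0) := by
    simpa using (tendsto_fst_smallStep (d := d) B).pow 2
  have hA0 : Tendsto A (smallStep d B) (𝓝 0) := hAO.trans_tendsto hsq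
  have h1 := (det_one_add_sub_isLittleO.comp_tendsto hA0).trans_isBigO hAO
  have hdet : ∀ x, (1 + Matrix.of (A x)).det = (1 - x.1 ^ 2 • (x.2.2 * x.2.2)).det := fun x => by
    rw [sub_eq_add_neg]
    rfl
  have htr : ∀ x, (Matrix.of (A x)).trace = -(x.1 ^ 2 * (x.2.2 * x.2.2).trace) := fun x => by
    simp [hA, Matrix.trace, Finset.mul_sum]
  simp only [Function.comp_def, hdet, htr] at h1
  set D : StepParam d → ℝ := fun x => (1 - x.1 ^ 2 • (x.2.2 * x.2.2)).det with hD
  have htrO : (fun x : StepParam d => x.1 ^ 2 * (x.2.2 * x.2.2).trace) =O[smallStep d B]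
      fun x => x.1 ^ 2 := by
    refine isBigO_mul_one (isBigO_refl _ _) ?_
    simp only [Matrix.trace, Matrix.diag, Matrix.mul_apply]
    exact IsBigO.fun_sum fun i _ => IsBigO.fun_sum fun k _ =>
      isBigO_one_mul (isBigO_weight B i k) (isBigO_weight B k i)
  have hD1 : (fun x => D x - 1) =O[smallStep d B] fun x => x.1 ^ 2 := by
    refine (h1.isBigO.sub htrO).congr_left fun x => ?_
    simp only [hD]
    ring
  have hDt : Tendsto D (smallStep d B) (𝓝 1) := by
    simpa using (hD1.trans_tendsto hsq).add_const 1
  have hlog := (hasDerivAt_iff_isLittleO.1 (Real.hasDerivAt_log (one_ne_zero (α := ℝ))))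
  have h2 := (hlog.comp_tendsto hDt).trans_isBigO hD1
  refine (h2.add h1).congr_left fun x => ?_
  simp only [Function.comp_def, hD, Real.log_one]
  simp
  ring

/-- The identity serves as a dummy moment matrix, through which statements about `W` alone are read
off from `smallStep`. -/
theorem one_weight_mem_admissible {B : ℝ} {W : Matrix (Fin d) (Fin d) ℝ}
    (hW : ∀ i j, |W i j| ≤ B) : (1, W) ∈ admissible d B := by
  refine ⟨fun i j => by simp [Matrix.one_apply, eq_comm], fun i => by simp, fun i j => ?_, hW⟩
  change |(1 : Matrix (Fin d) (Fin d) ℝ) i j| ≤ 1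
  rw [Matrix.one_apply]
  split_ifs <;> simp

theorem abs_log_det_one_sub_le (d : ℕ) (B : ℝ) {ε : ℝ} (hε : 0 < ε) :
    ∃ γ₀ : ℝ, 0 < γ₀ ∧ ∀ γ, 0 < γ → γ < γ₀ → ∀ W : Matrix (Fin d) (Fin d) ℝ,
      (∀ i j, |W i j| ≤ B) →
      |Real.log (1 - γ ^ 2 • (W * W)).det + γ ^ 2 * (W * W).trace| ≤ ε * γ ^ 2 := by
  obtain ⟨γ₀, h0, h1⟩ := exists_forall_of_eventually_smallStep
    ((log_det_one_sub_isLittleO d B).bound hε)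
  refine ⟨γ₀, h0, fun γ hγ hγ' W hW => ?_⟩
  simpa using h1 γ hγ hγ' 1 W (one_weight_mem_admissible hW)

/-- For small step sizes the residual layer is invertible and changes row norms little. -/
theorem exists_step_bounds (d : ℕ) (B : ℝ) :
    ∃ γ₀ : ℝ, 0 < γ₀ ∧ ∀ γ, 0 < γ → γ < γ₀ →
      (∀ W : Matrix (Fin d) (Fin d) ℝ, (∀ i j, |W i j| ≤ B) →
        (1 + γ • W).det ∈ Set.Icc (1 / 2 : ℝ) 2) ∧
      ∀ M W : Matrix (Fin d) (Fin d) ℝ, (M, W) ∈ admissible d B →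
        ∀ i, residualMoment γ W M i i ∈ Set.Icc (1 / 2 : ℝ) 2 := by
  have hI : Set.Icc (1 / 2 : ℝ) 2 ∈ 𝓝 (1 : ℝ) := Icc_mem_nhds (by norm_num) (by norm_num)
  have h1 := (tendsto_det_residual d B).eventually hI
  have h2 : ∀ᶠ x in smallStep d B, ∀ i, residualMoment x.1 x.2.2 x.2.1 i i ∈
      Set.Icc (1 / 2 : ℝ) 2 := eventually_all.2 fun i =>
    ((hasExpansion_residualMoment_diag B i).tendsto_one (tendsto_fst_smallStep B)).eventually hI
  obtain ⟨γ₀, h0, h⟩ := exists_forall_of_eventually_smallStep (h1.and h2)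
  exact ⟨γ₀, h0, fun γ hγ hγ' => ⟨fun W hW => (h γ hγ hγ' 1 W (one_weight_mem_admissible hW)).1,
    fun M W hMW => (h γ hγ hγ' M W hMW).2⟩⟩

theorem abs_log_le_one {x : ℝ} (hx : x ∈ Set.Icc (1 / 2 : ℝ) 2) : |Real.log x| ≤ 1 := by
  have h2 : Real.log 2 < 1 := by linarith [Real.log_two_lt_d9]
  have hx0 : 0 < x := by linarith [hx.1]
  rw [abs_le]
  constructor
  · have := Real.log_le_log (by norm_num) hx.1
    rw [one_div, Real.log_inv] at this
    linarith
  · linarith [Real.log_le_log hx0 hx.2]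

end Determinant

/-! ### Moments of the weight matrix -/

section Moments

variable {d N : ℕ}

instance matrixBorelSpace {m n : Type*} [Countable m] [Countable n] :
    BorelSpace (Matrix m n ℝ) :=
  inferInstanceAs (BorelSpace (m → n → ℝ))

/-- A centred, symmetric law of bounded weight matrices with uncorrelated entries of variance
one. -/
structure IsStandardLaw (B : ℝ) (μ : Measure (Matrix (Fin d) (Fin d) ℝ)) : Prop where
  isProbabilityMeasure : IsProbabilityMeasure μ
  bounded : ∀ᵐ W ∂μ, ∀ i j, |W i j| ≤ B
  mean : ∀ i j, ∫ W, W i j ∂μ = 0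
  cov : ∀ i j k l, ∫ W, W i j * W k l ∂μ = if i = k ∧ j = l then 1 else 0
  symm : μ.map (fun W => -W) = μ

/-- `f` is integrable with integral `c`. -/
def HasMean {α : Type*} [MeasurableSpace α] (μ : Measure α) (f : α → ℝ) (c : ℝ) : Prop :=
  Integrable f μ ∧ ∫ x, f x ∂μ = c

namespace HasMean

variable {α : Type*} [MeasurableSpace α] {μ : Measure α} {f g : α → ℝ} {a b : ℝ}

theorem add (hf : HasMean μ f a) (hg : HasMean μ g b) :
    HasMean μ (fun x => f x + g x) (a + b) :=
  ⟨hf.1.add hg.1, by rw [integral_add hf.1 hg.1, hf.2, hg.2]⟩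

theorem sub (hf : HasMean μ f a) (hg : HasMean μ g b) :
    HasMean μ (fun x => f x - g x) (a - b) :=
  ⟨hf.1.sub hg.1, by rw [integral_sub hf.1 hg.1, hf.2, hg.2]⟩

theorem const_mul (c : ℝ) (hf : HasMean μ f a) : HasMean μ (fun x => c * f x) (c * a) :=
  ⟨hf.1.const_mul c, by rw [integral_const_mul, hf.2]⟩

theorem const [IsProbabilityMeasure μ] (c : ℝ) : HasMean μ (fun _ => c) c :=
  ⟨integrable_const c, by simp⟩

theorem sum {ι : Type*} (s : Finset ι) {F : ι → α → ℝ} {c : ι → ℝ}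
    (h : ∀ i ∈ s, HasMean μ (F i) (c i)) : HasMean μ (fun x => ∑ i ∈ s, F i x) (∑ i ∈ s, c i) :=
  ⟨integrable_finsetSum s fun i hi => (h i hi).1, by
    rw [integral_finsetSum s fun i hi => (h i hi).1]
    exact Finset.sum_congr rfl fun i hi => (h i hi).2⟩

theorem congr (hf : HasMean μ f a) (h : ∀ x, g x = f x) (hab : a = b) : HasMean μ g b := by
  obtain rfl : g = f := funext h
  exact hab ▸ hf

end HasMean

namespace IsStandardLaw

variable {B : ℝ} {μ : Measure (Matrix (Fin d) (Fin d) ℝ)}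

theorem hasMean_entry (h : IsStandardLaw B μ) (i j : Fin d) : HasMean μ (fun W => W i j) 0 := by
  have := h.isProbabilityMeasure
  have hc : Continuous fun W : Matrix (Fin d) (Fin d) ℝ => W i j := by fun_prop
  refine ⟨Integrable.of_bound hc.measurable.aestronglyMeasurable B ?_, h.mean i j⟩
  filter_upwards [h.bounded] with W hW using hW i j

theorem hasMean_entry_mul (h : IsStandardLaw B μ) (i j k l : Fin d) :
    HasMean μ (fun W => W i j * W k l) (if i = k ∧ j = l then 1 else 0) := by
  have := h.isProbabilityMeasure
  have hc : Continuous fun W : Matrix (Fin d) (Fin d) ℝ => W i j * W k l := by fun_prop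
  refine ⟨Integrable.of_bound hc.measurable.aestronglyMeasurable (B * B) ?_, h.cov i j k l⟩
  filter_upwards [h.bounded] with W hW
  rw [Real.norm_eq_abs, abs_mul]
  exact mul_le_mul (hW i j) (hW k l) (abs_nonneg _) ((abs_nonneg _).trans (hW i j))

theorem hasMean_mul (h : IsStandardLaw B μ) (M : Matrix (Fin d) (Fin d) ℝ) (i j : Fin d) :
    HasMean μ (fun W => (W * M) i j) 0 := by
  refine (HasMean.sum Finset.univ fun m _ =>
    (h.hasMean_entry i m).const_mul (M m j)).congr (fun W => ?_) (by simp)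
  simp [Matrix.mul_apply, mul_comm]

/-- Different rows of `W` are uncorrelated and each row has identity covariance, so contracting with
the symmetric matrix `M` on both sides leaves `M²`. -/
theorem hasMean_mul_mul (h : IsStandardLaw B μ) {M : Matrix (Fin d) (Fin d) ℝ}
    (hM : ∀ i j, M i j = M j i) (i j k l : Fin d) :
    HasMean μ (fun W => (W * M) i j * (W * M) k l) (if i = k then (M ^ 2) j l else 0) := by
  refine (HasMean.sum Finset.univ fun m _ => HasMean.sum Finset.univ fun n _ =>
    (h.hasMean_entry_mul i m k n).const_mul (M m j * M n l)).congr (fun W => ?_) ?_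
  · rw [Matrix.mul_apply, Matrix.mul_apply, Finset.sum_mul_sum]
    exact Finset.sum_congr rfl fun m _ => Finset.sum_congr rfl fun n _ => by ring
  · by_cases hik : i = k
    · simp only [hik, true_and, if_true, mul_ite, mul_one, mul_zero, Finset.sum_ite_eq,
        Finset.mem_univ, pow_two, Matrix.mul_apply]
      exact Finset.sum_congr rfl fun m _ => by rw [hM m j]
    · simp [hik]

theorem hasMean_mul_transpose (h : IsStandardLaw B μ) (M : Matrix (Fin d) (Fin d) ℝ)
    (i j : Fin d) :
    HasMean μ (fun W => (W * M * Wᵀ) i j) (if i = j then M.trace else 0) := by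
  refine (HasMean.sum Finset.univ fun m _ => HasMean.sum Finset.univ fun n _ =>
    (h.hasMean_entry_mul i n j m).const_mul (M n m)).congr (fun W => ?_) ?_
  · rw [Matrix.mul_apply]
    refine Finset.sum_congr rfl fun m _ => ?_
    rw [Matrix.mul_apply, Finset.sum_mul]
    refine Finset.sum_congr rfl fun n _ => ?_
    rw [Matrix.transpose_apply]; ring
  · by_cases hij : i = j
    · simp [hij, Matrix.trace]
    · simp [hij]

theorem hasMean_trace_mul_self (h : IsStandardLaw B μ) :
    HasMean μ (fun W => (W * W).trace) d := by
  refine (HasMean.sum Finset.univ fun m _ => HasMean.sum Finset.univ fun n _ =>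
    h.hasMean_entry_mul m n n m).congr (fun W => ?_) ?_
  · simp [Matrix.trace, Matrix.mul_apply]
  · have : ∀ m n : Fin d, (m = n ∧ n = m) ↔ m = n := fun m n => ⟨And.left, fun h => ⟨h, h.symm⟩⟩
    simp [this]

theorem hasMean_coeffOne (h : IsStandardLaw B μ) (M : Matrix (Fin d) (Fin d) ℝ) :
    HasMean μ (fun W => ∑ i, ∑ j, coeffOne M W i j) 0 := by
  refine (HasMean.sum Finset.univ fun i _ => HasMean.sum Finset.univ fun j _ =>
    (((h.hasMean_mul M i j).add (h.hasMean_mul M j i)).const_mul (2 * M i j)).sub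
    (((h.hasMean_mul M i i).add (h.hasMean_mul M j j)).const_mul (2 * M i j ^ 2))).congr
    (fun W => rfl) (by simp)

/-- The drift of `frobSq`. The coefficient is quadratic in `W`, so only the covariance of the
entries enters. The value vanishes at the all-ones matrix, in accordance with rank-one states being
fixed. -/
theorem hasMean_coeffTwo (h : IsStandardLaw B μ) {M : Matrix (Fin d) (Fin d) ℝ}
    (hM : ∀ i j, M i j = M j i) (h1 : ∀ i, M i i = 1) :
    HasMean μ (fun W => ∑ i, ∑ j, coeffTwo M W i j)
      (2 * (d : ℝ) ^ 2 - 2 * frobSq M - 8 * (M ^ 3).trace + 8 * diagSqTrace M) := by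
  have a := h.hasMean_mul_mul hM
  have q := h.hasMean_mul_transpose M
  refine (HasMean.sum Finset.univ fun i _ => HasMean.sum Finset.univ fun j _ =>
    (((((a i j i j).add ((a i j j i).const_mul 2)).add (a j i j i)).add
      ((q i j).const_mul (2 * M i j))).add
    (((((((a i i i i).const_mul 4).add ((a j j j j).const_mul 4)).add
      ((a i i j j).const_mul 4)).sub (q i i)).sub (q j j)).const_mul (M i j ^ 2))).sub
    (((((a i j i i).add (a i j j j)).add (a j i i i)).add (a j i j j)).const_mul (4 * M i j))).congr
    (fun W => ?_) ?_
  · refine Finset.sum_congr rfl fun i _ => Finset.sum_congr rfl fun j _ => ?_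
    rw [coeffTwo]; ring
  · have htr : M.trace = d := by simp [Matrix.trace, h1]
    have hA : ∀ i, ∑ j, M i j ^ 2 = (M ^ 2) i i := fun i => by
      rw [pow_two M, Matrix.mul_apply]
      exact Finset.sum_congr rfl fun j _ => by rw [hM j i, pow_two]
    have hA' : ∀ j, ∑ i, M i j ^ 2 = (M ^ 2) j j := fun j => by
      rw [← hA j]
      exact Finset.sum_congr rfl fun i _ => by rw [hM]
    have hAs : ∀ i j, (M ^ 2) i j = (M ^ 2) j i := fun i j => by
      rw [pow_two, Matrix.mul_apply, Matrix.mul_apply]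
      exact Finset.sum_congr rfl fun k _ => by rw [hM i k, hM k j, mul_comm]
    have h2 : ∑ i, (M ^ 2) i i = frobSq M := by rw [frobSq_eq_trace hM]; rfl
    have h3 : ∑ i, ∑ j, M i j * (M ^ 2) i j = (M ^ 3).trace := by
      rw [pow_succ' M 2]
      simp only [Matrix.trace, Matrix.diag, Matrix.mul_apply (M := M)]
      exact Finset.sum_congr rfl fun i _ => Finset.sum_congr rfl fun j _ => by rw [hAs i j]
    -- The mean of each summand is a generic expression in `i, j` plus a correction on the diagonal,
    -- where further covariances are nonzero and `M i i = 1`.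
    have key : ∀ i j, (((((if i = i then (M ^ 2) j j else 0) +
        2 * (if i = j then (M ^ 2) j i else 0)) + (if j = j then (M ^ 2) i i else 0)) +
        2 * M i j * (if i = j then M.trace else 0)) +
        M i j ^ 2 * (4 * (if i = i then (M ^ 2) i i else 0) +
          4 * (if j = j then (M ^ 2) j j else 0) + 4 * (if i = j then (M ^ 2) i j else 0) -
          (if i = i then M.trace else 0) - (if j = j then M.trace else 0))) -
        4 * M i j * ((if i = i then (M ^ 2) j i else 0) + (if i = j then (M ^ 2) j j else 0) +
          (if j = i then (M ^ 2) i i else 0) + (if j = j then (M ^ 2) i j else 0)) =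
        (M ^ 2) i i + (M ^ 2) j j + 4 * (M i j ^ 2 * (M ^ 2) i i) +
        4 * (M i j ^ 2 * (M ^ 2) j j) - 2 * d * M i j ^ 2 - 8 * (M i j * (M ^ 2) i j) +
        if i = j then 2 * (d : ℝ) - 2 * (M ^ 2) i i else 0 := by
      intro i j
      rw [htr, hAs j i]
      by_cases hij : i = j
      · subst hij
        simp only [if_true, h1]
        ring
      · simp only [if_true, hij, Ne.symm hij, if_false]
        ring
    have e1 : ∑ i, ∑ j, 4 * (M i j ^ 2 * (M ^ 2) i i) = 4 * diagSqTrace M := by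
      simp only [← Finset.mul_sum, ← Finset.sum_mul, hA, diagSqTrace, pow_two ((M ^ 2) _ _)]
    have e2 : ∑ i, ∑ j, 4 * (M i j ^ 2 * (M ^ 2) j j) = 4 * diagSqTrace M := by
      rw [Finset.sum_comm]
      simp only [← Finset.mul_sum, ← Finset.sum_mul, hA', diagSqTrace, pow_two ((M ^ 2) _ _)]
    have e3 : ∑ i, ∑ j, 2 * (d : ℝ) * M i j ^ 2 = 2 * d * frobSq M := by
      simp only [← Finset.mul_sum, frobSq]
    have e4 : ∑ i, ∑ j, 8 * (M i j * (M ^ 2) i j) = 8 * (M ^ 3).trace := by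
      simp only [← Finset.mul_sum, h3]
    have e5 : ∑ i : Fin d, ∑ j, (if i = j then 2 * (d : ℝ) - 2 * (M ^ 2) i i else 0) =
        2 * d ^ 2 - 2 * frobSq M := by
      simp only [Finset.sum_ite_eq, Finset.mem_univ, if_true, Finset.sum_sub_distrib,
        ← Finset.mul_sum, h2]
      simp
      ring
    have e6 : ∑ i : Fin d, ∑ _j : Fin d, (M ^ 2) i i = d * frobSq M := by
      simp only [Finset.sum_const, Finset.card_univ, Fintype.card_fin, nsmul_eq_mul,
        ← Finset.mul_sum, h2]
    have e7 : ∑ _i : Fin d, ∑ j : Fin d, (M ^ 2) j j = d * frobSq M := by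
      simp only [h2, Finset.sum_const, Finset.card_univ, Fintype.card_fin, nsmul_eq_mul]
    refine (Finset.sum_congr rfl fun i _ => Finset.sum_congr rfl fun j _ => key i j).trans ?_
    simp only [Finset.sum_add_distrib, Finset.sum_sub_distrib, e1, e2, e3, e4, e5, e6, e7]
    ring

theorem hasMean_log_coeff (h : IsStandardLaw B μ) {M : Matrix (Fin d) (Fin d) ℝ}
    (hM : ∀ i j, M i j = M j i) (h1 : ∀ i, M i i = 1) :
    HasMean μ (fun W => ∑ i, ((W * M * Wᵀ) i i - 2 * (W * M) i i ^ 2))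
      ((d : ℝ) ^ 2 - 2 * frobSq M) := by
  refine (HasMean.sum Finset.univ fun i _ => (h.hasMean_mul_transpose M i i).sub
    ((h.hasMean_mul_mul hM i i i i).const_mul 2)).congr (fun W => ?_) ?_
  · exact Finset.sum_congr rfl fun i _ => by ring
  · have htr : M.trace = d := by simp [Matrix.trace, h1]
    have h2 : ∑ i, (M ^ 2) i i = frobSq M := by rw [frobSq_eq_trace hM]; rfl
    simp only [if_true, htr, Finset.sum_sub_distrib, ← Finset.mul_sum, h2]
    simp
    ring

end IsStandardLaw

end Moments

end BNNet

end

noncomputable section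

namespace BNNet

/-! ### One step drifts -/

section Drift

variable {d : ℕ}

instance matrixSecondCountable {m n : Type*} [Countable m] [Countable n] :
    SecondCountableTopology (Matrix m n ℝ) :=
  inferInstanceAs (SecondCountableTopology (m → n → ℝ))

/-- Carries a pointwise expansion over to expectations: `p` is the explicit polynomial in the
weights, `f` the exact quantity. -/
theorem HasMean.abs_integral_sub_le {α : Type*} [MeasurableSpace α] {μ : Measure α}
    [IsProbabilityMeasure μ] {p f : α → ℝ} {m c : ℝ} (hp : HasMean μ p m) (hf : Measurable f)
    (h : ∀ᵐ x ∂μ, |f x - p x| ≤ c) : Integrable f μ ∧ |∫ x, f x ∂μ - m| ≤ c := by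
  have h1 : Integrable (fun x => f x - p x) μ :=
    Integrable.of_bound (hf.aestronglyMeasurable.sub hp.1.aestronglyMeasurable) c h
  have h2 : Integrable f μ :=
    (h1.add hp.1).congr (Eventually.of_forall fun x => by simp)
  refine ⟨h2, ?_⟩
  rw [← hp.2, ← integral_sub h2 hp.1]
  have := norm_integral_le_of_norm_le_const (μ := μ) (f := fun x => f x - p x) h
  simpa using this

/-- The increment of `log det M(H)` under one layer. -/
def logDetStep (γ : ℝ) (W M : Matrix (Fin d) (Fin d) ℝ) : ℝ :=
  2 * Real.log (1 + γ • W).det - ∑ i, Real.log (residualMoment γ W M i i)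

theorem continuous_residualMoment (γ : ℝ) (i j : Fin d) :
    Continuous fun p : Matrix (Fin d) (Fin d) ℝ × Matrix (Fin d) (Fin d) ℝ =>
      residualMoment γ p.1 p.2 i j := by
  have : Continuous fun p : Matrix (Fin d) (Fin d) ℝ × Matrix (Fin d) (Fin d) ℝ =>
      residualMoment γ p.1 p.2 := by
    unfold residualMoment
    fun_prop
  fun_prop

theorem measurable_nextFrobSq (γ : ℝ) :
    Measurable fun p : Matrix (Fin d) (Fin d) ℝ × Matrix (Fin d) (Fin d) ℝ =>
      nextFrobSq γ p.1 p.2 := by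
  have h := fun i j => (continuous_residualMoment (d := d) γ i j).measurable
  unfold nextFrobSq
  fun_prop

theorem measurable_det_residual (γ : ℝ) :
    Measurable fun W : Matrix (Fin d) (Fin d) ℝ => (1 + γ • W).det := by
  have h : Continuous fun W : Matrix (Fin d) (Fin d) ℝ => (1 + γ • W).det := by fun_prop
  exact h.measurable

theorem measurable_logDetStep (γ : ℝ) :
    Measurable fun p : Matrix (Fin d) (Fin d) ℝ × Matrix (Fin d) (Fin d) ℝ =>
      logDetStep γ p.1 p.2 := by
  have h := fun i => (continuous_residualMoment (d := d) γ i i).measurable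
  have h2 : Measurable fun p : Matrix (Fin d) (Fin d) ℝ × Matrix (Fin d) (Fin d) ℝ =>
      (1 + γ • p.1).det := (measurable_det_residual (d := d) γ).comp measurable_fst
  unfold logDetStep
  refine (h2.log.const_mul 2).sub (Finset.measurable_sum _ fun i _ => (h i).log)

theorem measurable_pair_left {α β γ' : Type*} [MeasurableSpace α] [MeasurableSpace β]
    [MeasurableSpace γ'] {f : α × β → γ'} (hf : Measurable f) (y : β) :
    Measurable fun x => f (x, y) :=
  hf.comp (measurable_id.prodMk measurable_const)

/-- Symmetric matrices with unit diagonal and entries in `[-1, 1]`. -/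
structure IsCorrelation (M : Matrix (Fin d) (Fin d) ℝ) : Prop where
  symm : ∀ i j, M i j = M j i
  diag : ∀ i, M i i = 1
  abs_le : ∀ i j, |M i j| ≤ 1

theorem IsCorrelation.mem_admissible {M W : Matrix (Fin d) (Fin d) ℝ} {B : ℝ}
    (hM : IsCorrelation M) (hW : ∀ i j, |W i j| ≤ B) : (M, W) ∈ admissible d B :=
  ⟨hM.symm, hM.diag, hM.abs_le, hW⟩

theorem abs_integral_nextFrobSq_sub_le (d : ℕ) (B : ℝ) {ε : ℝ} (hε : 0 < ε) :
    ∃ γ₀ : ℝ, 0 < γ₀ ∧ ∀ γ, 0 < γ → γ < γ₀ → ∀ M : Matrix (Fin d) (Fin d) ℝ, IsCorrelation M →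
      ∀ μ : Measure (Matrix (Fin d) (Fin d) ℝ), IsStandardLaw B μ →
      |∫ W, nextFrobSq γ W M ∂μ - (frobSq M + γ ^ 2 *
        (2 * (d : ℝ) ^ 2 - 2 * frobSq M - 8 * (M ^ 3).trace + 8 * diagSqTrace M))| ≤
        ε * γ ^ 2 := by
  obtain ⟨γ₀, h0, h⟩ := abs_nextFrobSq_sub_le d B hε
  refine ⟨γ₀, h0, fun γ hγ hγ' M hM μ hμ => ?_⟩
  have := hμ.isProbabilityMeasure
  have hp := ((HasMean.const (μ := μ) (frobSq M)).add ((hμ.hasMean_coeffOne M).const_mul γ)).add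
    ((hμ.hasMean_coeffTwo hM.symm hM.diag).const_mul (γ ^ 2))
  rw [mul_zero, add_zero] at hp
  refine (hp.abs_integral_sub_le (measurable_pair_left (measurable_nextFrobSq γ) M) ?_).2
  filter_upwards [hμ.bounded] with W hW
  exact h γ hγ hγ' M W (hM.mem_admissible hW)

/-- Symmetry of the law lets `2 E log det(1 + γW)` be written as `E log det(1 - γ²W²)`, which is
about `-γ² E Tr(W²) = -γ² d`. The row normalization contributes the remaining `-γ²(d² - 2F)`. Each
half receives half of `ε`. -/
theorem le_integral_logDetStep (d : ℕ) (B : ℝ) {ε : ℝ} (hε : 0 < ε) :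
    ∃ γ₀ : ℝ, 0 < γ₀ ∧ ∀ γ, 0 < γ → γ < γ₀ → ∀ M : Matrix (Fin d) (Fin d) ℝ, IsCorrelation M →
      ∀ μ : Measure (Matrix (Fin d) (Fin d) ℝ), IsStandardLaw B μ →
      γ ^ 2 * (2 * frobSq M - d - (d : ℝ) ^ 2 - ε) ≤ ∫ W, logDetStep γ W M ∂μ := by
  obtain ⟨γ₁, h1, hlog⟩ := abs_sum_log_residualMoment_sub_le d B (half_pos hε)
  obtain ⟨γ₂, h2, hdet⟩ := abs_log_det_one_sub_le d B (half_pos hε)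
  obtain ⟨γ₃, h3, hb⟩ := exists_step_bounds d B
  refine ⟨min γ₁ (min γ₂ γ₃), lt_min h1 (lt_min h2 h3), fun γ hγ hγ' M hM μ hμ => ?_⟩
  have hγ1 : γ < γ₁ := hγ'.trans_le (min_le_left _ _)
  have hγ2 : γ < γ₂ := hγ'.trans_le ((min_le_right _ _).trans (min_le_left _ _))
  have hγ3 : γ < γ₃ := hγ'.trans_le ((min_le_right _ _).trans (min_le_right _ _))
  have := hμ.isProbabilityMeasure
  have hp := ((HasMean.sum Finset.univ fun i _ => (hμ.hasMean_mul M i i).const_mul 2).const_mul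
    γ).add ((hμ.hasMean_log_coeff hM.symm hM.diag).const_mul (γ ^ 2))
  have hN : Measurable fun W : Matrix (Fin d) (Fin d) ℝ =>
      ∑ i, Real.log (residualMoment γ W M i i) :=
    Finset.measurable_sum _ fun i _ =>
      (measurable_pair_left (continuous_residualMoment γ i i).measurable M).log
  obtain ⟨hNi, hNl⟩ := hp.abs_integral_sub_le (c := ε / 2 * γ ^ 2) hN (by
    filter_upwards [hμ.bounded] with W hW
    exact hlog γ hγ hγ1 M W (hM.mem_admissible hW))
  set u : Matrix (Fin d) (Fin d) ℝ → ℝ := fun W => Real.log (1 + γ • W).det with hu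
  have hum : Measurable u := (measurable_det_residual γ).log
  have hui : Integrable u μ := by
    refine Integrable.of_bound hum.aestronglyMeasurable 1 ?_
    filter_upwards [hμ.bounded] with W hW
    exact abs_log_le_one ((hb γ hγ hγ3).1 W hW)
  have hneg : Measurable fun W : Matrix (Fin d) (Fin d) ℝ => -W := by
    have : Continuous fun W : Matrix (Fin d) (Fin d) ℝ => -W := by fun_prop
    exact this.measurable
  have husymm : ∫ W, u (-W) ∂μ = ∫ W, u W ∂μ := by
    conv_rhs => rw [← hμ.symm]
    rw [integral_map hneg.aemeasurable hum.aestronglyMeasurable]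
  have hui' : Integrable (fun W => u (-W)) μ := by
    have h : Integrable u (μ.map fun W => -W) := by rwa [hμ.symm]
    exact h.comp_measurable hneg
  have hvm : Measurable fun W => u W + u (-W) := hum.add (hum.comp hneg)
  have hv := ((hμ.hasMean_trace_mul_self.const_mul (-γ ^ 2)).abs_integral_sub_le
    (c := ε / 2 * γ ^ 2) hvm (by
    filter_upwards [hμ.bounded] with W hW
    have hW' : ∀ i j, |(-W) i j| ≤ B := fun i j => by simpa using hW i j
    have e1 := ((hb γ hγ hγ3).1 W hW).1
    have e2 := ((hb γ hγ hγ3).1 (-W) hW').1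
    -- Pairing `W` with `-W` cancels the first-order term before any expansion is made.
    have e3 : (1 + γ • W) * (1 + γ • (-W)) = 1 - γ ^ 2 • (W * W) := by
      simp only [smul_neg, Matrix.mul_add, Matrix.add_mul, Matrix.mul_neg, Matrix.one_mul,
        Matrix.mul_one, Matrix.smul_mul, Matrix.mul_smul, pow_two]
      module
    simp only [hu]
    rw [← Real.log_mul (by linarith) (by linarith), ← Matrix.det_mul, e3]
    have := hdet γ hγ hγ2 W hW
    rwa [neg_mul, sub_neg_eq_add])).2
  rw [integral_add hui hui', husymm] at hv
  have hint : ∫ W, logDetStep γ W M ∂μ =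
      2 * ∫ W, u W ∂μ - ∫ W, ∑ i, Real.log (residualMoment γ W M i i) ∂μ := by
    simp only [logDetStep]
    rw [integral_sub (hui.const_mul 2) hNi, integral_const_mul]
  rw [hint]
  simp only [mul_zero, Finset.sum_const_zero, zero_add] at hNl
  have a1 := (abs_le.1 hNl).2
  have a2 := (abs_le.1 hv).1
  linarith

end Drift

end BNNet

end

noncomputable section

namespace BNNet

/-! ### The law of the weights and the dependence structure of the chain -/

section Law

variable {d N : ℕ}

theorem measurable_matrix {α m n : Type*} [MeasurableSpace α] {f : α → Matrix m n ℝ}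
    (h : ∀ i j, Measurable fun a => f a i j) : Measurable f :=
  measurable_pi_iff.2 fun i => measurable_pi_iff.2 fun j => h i j

theorem measurable_matrix_entry {m n : Type*} (i : m) (j : n) :
    Measurable fun W : Matrix m n ℝ => W i j :=
  (measurable_pi_apply (X := fun _ : n => ℝ) j).comp (measurable_pi_apply (X := fun _ : m => n → ℝ) i)

variable {Ω : Type*} [MeasurableSpace Ω] {Pr : Measure Ω} {P : Measure ℝ}

/-- Independence gives the product law over pairs of indices, and currying turns it into the
iterated product that defines `weightMatrixLaw`. -/
theorem hasLaw_weightMatrixLaw [IsProbabilityMeasure P] {Z : Ω → Matrix (Fin d) (Fin d) ℝ}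
    (hl : ∀ i j, HasLaw (fun ω => Z ω i j) P Pr)
    (hi : iIndepFun (fun (p : Fin d × Fin d) ω => Z ω p.1 p.2) Pr) :
    HasLaw Z (weightMatrixLaw d P) Pr := by
  have hm : AEMeasurable (fun ω (p : Fin d × Fin d) => Z ω p.1 p.2) Pr :=
    aemeasurable_pi_iff.2 fun p : Fin d × Fin d => (hl p.1 p.2).aemeasurable
  have h1 := hi.hasLaw_infinitePi (μ := fun _ => P) (fun p : Fin d × Fin d => hl p.1 p.2) hm
  have h2 := Measure.infinitePi_map_curry (fun _ _ : Fin d => P)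
  simp only [Measure.infinitePi_eq_pi] at h1 h2
  have h3 : HasLaw (MeasurableEquiv.curry (Fin d) (Fin d) ℝ)
      (Measure.pi fun _ : Fin d => Measure.pi fun _ : Fin d => P)
      (Measure.pi fun _ : Fin d × Fin d => P) :=
    ⟨(MeasurableEquiv.curry (Fin d) (Fin d) ℝ).measurable.aemeasurable, h2⟩
  have h4 : HasLaw (Matrix.of : (Fin d → Fin d → ℝ) → Matrix (Fin d) (Fin d) ℝ)
      (weightMatrixLaw d P) (Measure.pi fun _ : Fin d => Measure.pi fun _ : Fin d => P) :=
    ⟨(measurable_id : Measurable (id : (Fin d → Fin d → ℝ) → _)).aemeasurable, rfl⟩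
  exact h4.comp (h3.comp h1)

variable {W : ℕ → Ω → Matrix (Fin d) (Fin d) ℝ}

theorem IsIIDWeights.hasLaw [IsProbabilityMeasure P] (h : IsIIDWeights Pr P W) (ℓ : ℕ) :
    HasLaw (W ℓ) (weightMatrixLaw d P) Pr :=
  hasLaw_weightMatrixLaw (h.law ℓ) <| h.indep.precomp (g := fun p : Fin d × Fin d => (ℓ, p.1, p.2))
    fun p q hpq => by
      simp only [Prod.mk.injEq, true_and] at hpq
      exact Prod.ext hpq.1 hpq.2

theorem IsIIDWeights.isStandardLaw [IsProbabilityMeasure Pr] {B : ℝ} (hP : IsWeightLaw B P)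
    (h : IsIIDWeights Pr P W) : IsStandardLaw B (weightMatrixLaw d P) := by
  have := hP.isProbabilityMeasure
  have hW := h.hasLaw 0
  have hent := fun i j : Fin d => measurable_matrix_entry i j
  have hint : ∀ i j k l, IndepFun (fun ω => W 0 ω i j) (fun ω => W 0 ω k l) Pr ∨
      (i = k ∧ j = l) := fun i j k l => by
    by_cases hh : i = k ∧ j = l
    · exact .inr hh
    · refine .inl (h.indep.indepFun (i := (0, i, j)) (j := (0, k, l)) fun he => hh ?_)
      simpa using he
  have hm : ∀ i j, ∫ ω, W 0 ω i j ∂Pr = 0 := fun i j => by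
    have := (h.law 0 i j).integral_comp (f := fun x : ℝ => x) (by fun_prop)
    rwa [hP.mean_zero] at this
  constructor
  · exact hW.isProbabilityMeasure_iff.1 inferInstance
  · refine ae_all_iff.2 fun i => ae_all_iff.2 fun j => ?_
    have hp : MeasurableSet {W : Matrix (Fin d) (Fin d) ℝ | |W i j| ≤ B} :=
      measurableSet_le (hent i j).abs measurable_const
    rw [← hW.map_eq, ae_map_iff hW.aemeasurable hp]
    have h2 := hP.support
    rw [← (h.law 0 i j).map_eq] at h2
    have h3 := ae_of_ae_map (h.law 0 i j).aemeasurable h2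
    filter_upwards [h3] with ω hω using abs_le.2 hω
  · intro i j
    rw [← hW.integral_comp (f := fun W => W i j) (hent i j).aestronglyMeasurable]
    exact hm i j
  · intro i j k l
    rw [← hW.integral_comp (f := fun W => W i j * W k l)
      ((hent i j).mul (hent k l)).aestronglyMeasurable]
    simp only [Function.comp_def]
    split_ifs with hh
    · obtain ⟨rfl, rfl⟩ := hh
      have := (h.law 0 i j).integral_comp (f := fun x : ℝ => x ^ 2) (by fun_prop)
      rw [hP.variance_one] at this
      simpa [pow_two] using this
    · rcases hint i j k l with h1 | h1
      · rw [h1.integral_fun_mul_eq_mul_integral (h.law 0 i j).aemeasurable.aestronglyMeasurable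
          (h.law 0 k l).aemeasurable.aestronglyMeasurable, hm, zero_mul]
      · exact absurd h1 hh
  -- The negated entries are again i.i.d. with law `P`, so `-W` and `W` have the same matrix law.
  · have hn : HasLaw (fun ω => -W 0 ω) (weightMatrixLaw d P) Pr := by
      have hneg : HasLaw (fun x : ℝ => -x) P P := ⟨by fun_prop, hP.symmetric⟩
      refine hasLaw_weightMatrixLaw (fun i j => hneg.comp (h.law 0 i j)) ?_
      have h1 := h.indep.precomp (g := fun p : Fin d × Fin d => (0, p.1, p.2))
        fun p q hpq => by
          simp only [Prod.mk.injEq, true_and] at hpq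
          exact Prod.ext hpq.1 hpq.2
      exact h1.comp (fun _ x => -x) fun _ => measurable_neg
    have hneg : Measurable fun W : Matrix (Fin d) (Fin d) ℝ => -W :=
      measurable_matrix fun i j => (hent i j).neg
    conv_lhs => rw [← hW.map_eq]
    rw [AEMeasurable.map_map_of_aemeasurable hneg.aemeasurable hW.aemeasurable]
    exact hn.map_eq

theorem IsIIDWeights.ae_bounded {B : ℝ} (hP : IsWeightLaw B P) (h : IsIIDWeights Pr P W) :
    ∀ᵐ ω ∂Pr, ∀ ℓ i j, |W ℓ ω i j| ≤ B := by
  refine ae_all_iff.2 fun ℓ => ae_all_iff.2 fun i => ae_all_iff.2 fun j => ?_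
  have h2 := hP.support
  rw [← (h.law ℓ i j).map_eq] at h2
  have h3 := ae_of_ae_map (h.law ℓ i j).aemeasurable h2
  filter_upwards [h3] with ω hω using abs_le.2 hω

/-- The weights of the layers before `n`, the others being set to zero. -/
def truncate (n : ℕ) (w : ℕ → Matrix (Fin d) (Fin d) ℝ) : ℕ → Matrix (Fin d) (Fin d) ℝ :=
  fun k => if k < n then w k else 0

theorem IsIIDWeights.aemeasurable (h : IsIIDWeights Pr P W) :
    AEMeasurable (fun ω k => W k ω) Pr :=
  aemeasurable_pi_iff.2 fun k => aemeasurable_pi_iff.2 fun i => aemeasurable_pi_iff.2 fun j =>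
    (h.law k i j).aemeasurable

/-- A function of the weights before layer `n` is independent of the weights of layer `n`. -/
theorem IsIIDWeights.indepFun_past (h : IsIIDWeights Pr P W) {β : Type*} [MeasurableSpace β]
    (n : ℕ) {f : (ℕ → Matrix (Fin d) (Fin d) ℝ) → β} (hf : Measurable f)
    (hn : ∀ w, f (truncate n w) = f w) : IndepFun (fun ω => f fun k => W k ω) (W n) Pr := by
  classical
  let S : Finset (ℕ × Fin d × Fin d) := Finset.range n ×ˢ Finset.univ
  let T : Finset (ℕ × Fin d × Fin d) := {n} ×ˢ Finset.univ
  have hST : Disjoint S T := by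
    rw [Finset.disjoint_left]
    intro p hp hq
    simp only [S, T, Finset.mem_product, Finset.mem_range, Finset.mem_univ, and_true,
      Finset.mem_singleton] at hp hq
    omega
  have h0 := h.indep.indepFun_finset₀ S T hST fun p => (h.law p.1 p.2.1 p.2.2).aemeasurable
  -- `E` rebuilds the truncated weight sequence from the finitely many entries before layer `n`;
  -- `hn` says that `f` sees nothing else.
  let E : (S → ℝ) → ℕ → Matrix (Fin d) (Fin d) ℝ := fun t k i j =>
    if hk : (k, i, j) ∈ S then t ⟨(k, i, j), hk⟩ else 0
  have hE : Measurable E := measurable_pi_iff.2 fun k => measurable_matrix fun i j => by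
    by_cases hk : (k, i, j) ∈ S
    · simp only [E, hk, dif_pos]
      exact measurable_pi_apply _
    · simp only [E, hk, dif_neg, not_false_eq_true]
      exact measurable_const
  let D : (T → ℝ) → Matrix (Fin d) (Fin d) ℝ := fun t i j =>
    t ⟨(n, i, j), by simp [T]⟩
  have hD : Measurable D := measurable_matrix fun i j => measurable_pi_apply _
  have h1 := h0.comp (hf.comp hE) hD
  have e1 : (f ∘ E) ∘ (fun ω (i : S) => W (i : ℕ × Fin d × Fin d).1 ω
      (i : ℕ × Fin d × Fin d).2.1 (i : ℕ × Fin d × Fin d).2.2) = fun ω => f fun k => W k ω := by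
    funext ω
    simp only [Function.comp_apply]
    rw [← hn fun k => W k ω]
    congr 1
    funext k i j
    by_cases hk : k < n
    · simp [E, S, truncate, hk]
    · simp [E, S, truncate, hk]
  rw [e1] at h1
  exact h1

theorem measurable_batchNorm :
    Measurable (batchNorm : Matrix (Fin d) (Fin N) ℝ → Matrix (Fin d) (Fin N) ℝ) := by
  have hent := fun (i : Fin d) (j : Fin N) => measurable_matrix_entry i j
  refine measurable_matrix fun i j => ?_
  simp only [batchNorm, Matrix.diagonal_mul, secondMoment_apply]
  fun_prop

theorem measurable_residual (γ : ℝ) :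
    Measurable fun p : Matrix (Fin d) (Fin d) ℝ × Matrix (Fin d) (Fin N) ℝ =>
      p.2 + γ • (p.1 * p.2) := by
  have : Continuous fun p : Matrix (Fin d) (Fin d) ℝ × Matrix (Fin d) (Fin N) ℝ =>
      p.2 + γ • (p.1 * p.2) := by fun_prop
  exact this.measurable

theorem measurable_layer (γ : ℝ) :
    Measurable fun p : Matrix (Fin d) (Fin d) ℝ × Matrix (Fin d) (Fin N) ℝ =>
      layer γ p.1 p.2 := by
  unfold layer
  exact (measurable_batchNorm (d := d) (N := N)).comp (measurable_residual (d := d) (N := N) γ)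

theorem measurable_hidden (γ : ℝ) (X : Matrix (Fin d) (Fin N) ℝ) (ℓ : ℕ) :
    Measurable fun w : ℕ → Matrix (Fin d) (Fin d) ℝ => hidden γ X w ℓ := by
  induction ℓ with
  | zero => exact measurable_const
  | succ ℓ ih =>
    have h : Measurable fun w : ℕ → Matrix (Fin d) (Fin d) ℝ => (w ℓ, hidden γ X w ℓ) :=
      (measurable_pi_apply ℓ).prodMk ih
    have h2 := (measurable_layer (d := d) (N := N) γ).comp h
    simp only [Function.comp_def] at h2
    exact h2

theorem hidden_truncate (γ : ℝ) (X : Matrix (Fin d) (Fin N) ℝ)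
    (w : ℕ → Matrix (Fin d) (Fin d) ℝ) {ℓ n : ℕ} (hn : ℓ ≤ n) :
    hidden γ X (truncate n w) ℓ = hidden γ X w ℓ := by
  induction ℓ with
  | zero => rfl
  | succ ℓ ih =>
    have hlt : ℓ < n := hn
    rw [hidden, hidden, ih hlt.le, truncate, if_pos hlt]

end Law

/-! ### A law of large numbers for the chain -/

section LLN

variable {Ω : Type*} [MeasurableSpace Ω] {Pr : Measure Ω} [IsProbabilityMeasure Pr]

/-- A strong law of large numbers along the squares for bounded orthogonal variables. -/
theorem ae_tendsto_average_of_orthogonal {Y : ℕ → Ω → ℝ} {C : ℝ}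
    (hm : ∀ ℓ, AEMeasurable (Y ℓ) Pr) (hb : ∀ ℓ ω, |Y ℓ ω| ≤ C)
    (ho : ∀ i j, i < j → ∫ ω, Y i ω * Y j ω ∂Pr = 0) :
    ∀ᵐ ω ∂Pr, Tendsto (fun n : ℕ => ((n ^ 2 : ℕ) : ℝ)⁻¹ * ∑ ℓ ∈ Finset.Icc 1 (n ^ 2), Y ℓ ω)
      atTop (𝓝 0) := by
  set Z : ℕ → Ω → ℝ := fun n ω => ((n ^ 2 : ℕ) : ℝ)⁻¹ * ∑ ℓ ∈ Finset.Icc 1 (n ^ 2), Y ℓ ω with hZ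
  have hint : ∀ i j, Integrable (fun ω => Y i ω * Y j ω) Pr := fun i j => by
    refine Integrable.of_bound ((hm i).mul (hm j)).aestronglyMeasurable (C * C)
      (.of_forall fun ω => ?_)
    rw [Real.norm_eq_abs, abs_mul]
    exact mul_le_mul (hb i ω) (hb j ω) (abs_nonneg _) ((abs_nonneg _).trans (hb i ω))
  have hoff : ∀ i j, i ≠ j → ∫ ω, Y i ω * Y j ω ∂Pr = 0 := fun i j hij => by
    rcases lt_or_gt_of_ne hij with h | h
    · exact ho i j h
    · simpa [mul_comm] using ho j i h
  have hsq : ∀ i, ∫ ω, Y i ω * Y i ω ∂Pr ≤ C ^ 2 := fun i => by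
    have := integral_mono (hint i i) (integrable_const (C ^ 2)) fun ω => by
      have := abs_le_abs_of_nonneg (abs_nonneg _) (hb i ω)
      rw [abs_abs] at this
      change Y i ω * Y i ω ≤ C ^ 2
      rw [← pow_two]
      exact sq_le_sq.2 this
    simpa using this
  have hZm : ∀ n, AEMeasurable (Z n) Pr := fun n =>
    (Finset.aemeasurable_fun_sum _ fun i _ => hm i).const_mul _
  have hZeq : ∀ n ω, Z n ω ^ 2 = (((n ^ 2 : ℕ) : ℝ)⁻¹) ^ 2 *
      ∑ i ∈ Finset.Icc 1 (n ^ 2), ∑ j ∈ Finset.Icc 1 (n ^ 2), Y i ω * Y j ω := fun n ω => by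
    simp only [hZ, mul_pow]
    rw [pow_two (∑ ℓ ∈ Finset.Icc 1 (n ^ 2), Y ℓ ω), Finset.sum_mul_sum]
  have hZi : ∀ n, Integrable (fun ω => Z n ω ^ 2) Pr := fun n => by
    simp only [hZeq]
    exact (integrable_finsetSum _ fun i _ => integrable_finsetSum _ fun j _ =>
      hint i j).const_mul _
  -- Orthogonality leaves only the `n²` diagonal terms, against a prefactor `n⁻⁴`.
  have hZb : ∀ n : ℕ, ∫ ω, Z n ω ^ 2 ∂Pr ≤ C ^ 2 * (1 / (n : ℝ) ^ 2) := fun n => by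
    simp only [hZeq]
    rw [integral_const_mul, integral_finsetSum _ fun i _ => integrable_finsetSum _ fun j _ =>
      hint i j]
    have h1 : ∀ i ∈ Finset.Icc 1 (n ^ 2),
        ∫ ω, ∑ j ∈ Finset.Icc 1 (n ^ 2), Y i ω * Y j ω ∂Pr ≤ C ^ 2 := fun i hi => by
      rw [integral_finsetSum _ fun j _ => hint i j,
        Finset.sum_eq_single_of_mem i hi fun j _ hj => hoff i j hj.symm]
      exact hsq i
    have h2 := Finset.sum_le_card_nsmul _ _ _ h1
    rw [Nat.card_Icc, Nat.add_sub_cancel, nsmul_eq_mul] at h2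
    refine (mul_le_mul_of_nonneg_left h2 (by positivity)).trans (le_of_eq ?_)
    rcases eq_or_ne n 0 with rfl | hn
    · simp
    · have : (n : ℝ) ≠ 0 := by exact_mod_cast hn
      push_cast
      field_simp
  -- Averaging along squares makes these second moments summable. Hence `∑ Zₙ²` is almost surely
  -- finite and its terms tend to zero.
  have hsum : ∑' n, ∫⁻ ω, ENNReal.ofReal (Z n ω ^ 2) ∂Pr ≠ ⊤ := by
    have hs : Summable fun n : ℕ => C ^ 2 * (1 / (n : ℝ) ^ 2) :=
      (Real.summable_one_div_nat_pow.2 one_lt_two).mul_left _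
    have hle : ∀ n, ∫⁻ ω, ENNReal.ofReal (Z n ω ^ 2) ∂Pr ≤
        ENNReal.ofReal (C ^ 2 * (1 / (n : ℝ) ^ 2)) := fun n => by
      rw [← ofReal_integral_eq_lintegral_ofReal (hZi n) (.of_forall fun ω => sq_nonneg _)]
      exact ENNReal.ofReal_le_ofReal (hZb n)
    refine ne_top_of_le_ne_top ?_ (ENNReal.tsum_le_tsum hle)
    exact hs.tsum_ofReal_ne_top
  have hm2 : ∀ n, AEMeasurable (fun ω => ENNReal.ofReal (Z n ω ^ 2)) Pr := fun n =>
    ((hZm n).pow_const 2).ennreal_ofReal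
  rw [← lintegral_tsum hm2] at hsum
  filter_upwards [ae_lt_top' (AEMeasurable.tsum hm2) hsum] with ω hω
  have h0 := ENNReal.tendsto_atTop_zero_of_tsum_ne_top hω.ne
  have h1 : Tendsto (fun n => Z n ω ^ 2) atTop (𝓝 0) := by
    have := (ENNReal.tendsto_toReal ENNReal.zero_ne_top).comp h0
    simpa [Function.comp_def, ENNReal.toReal_ofReal, sq_nonneg] using this
  have h2 := h1.sqrt
  simp only [Real.sqrt_sq_eq_abs, Real.sqrt_zero] at h2
  exact (tendsto_zero_iff_abs_tendsto_zero _).2 h2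

variable {d N : ℕ} {P : Measure ℝ} {W : ℕ → Ω → Matrix (Fin d) (Fin d) ℝ}

/-- Along the chain, averages of a bounded function of weights and hidden representation agree
asymptotically with the averages of its conditional expectations. -/
theorem IsIIDWeights.ae_tendsto_average [IsProbabilityMeasure P] (h : IsIIDWeights Pr P W) (γ : ℝ)
    (X : Matrix (Fin d) (Fin N) ℝ)
    {φ : Matrix (Fin d) (Fin d) ℝ × Matrix (Fin d) (Fin N) ℝ → ℝ} (hφ : Measurable φ) {C : ℝ}
    (hC : ∀ p, |φ p| ≤ C) :
    ∀ᵐ ω ∂Pr, Tendsto (fun n : ℕ => ((n ^ 2 : ℕ) : ℝ)⁻¹ * ∑ ℓ ∈ Finset.Icc 1 (n ^ 2),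
      (φ (W ℓ ω, hidden γ X (fun k => W k ω) ℓ) -
        ∫ w, φ (w, hidden γ X (fun k => W k ω) ℓ) ∂(weightMatrixLaw d P))) atTop (𝓝 0) := by
  set μ := weightMatrixLaw d P
  have hprob : IsProbabilityMeasure μ := (h.hasLaw 0).isProbabilityMeasure_iff.1 inferInstance
  have hbar : Measurable fun H => ∫ w, φ (w, H) ∂μ :=
    (hφ.stronglyMeasurable.integral_prod_left' (μ := μ)).measurable
  have hbarC : ∀ H, |∫ w, φ (w, H) ∂μ| ≤ C := fun H => by
    have := norm_integral_le_of_norm_le_const (μ := μ) (f := fun w => φ (w, H))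
      (.of_forall fun w => hC (w, H))
    simpa using this
  set ψ : Matrix (Fin d) (Fin d) ℝ × Matrix (Fin d) (Fin N) ℝ → ℝ :=
    fun p => φ p - ∫ w, φ (w, p.2) ∂μ with hψ
  have hψm : Measurable ψ := hφ.sub (hbar.comp measurable_snd)
  have hψC : ∀ p, |ψ p| ≤ C + C := fun p =>
    (abs_sub _ _).trans (add_le_add (hC p) (hbarC p.2))
  have hψ0 : ∀ H, ∫ w, ψ (w, H) ∂μ = 0 := fun H => by
    have hi : Integrable (fun w => φ (w, H)) μ :=
      Integrable.of_bound (measurable_pair_left hφ H).aestronglyMeasurable C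
        (.of_forall fun w => hC (w, H))
    simp only [hψ]
    rw [integral_sub hi (integrable_const _)]
    simp
  set G : ℕ → (ℕ → Matrix (Fin d) (Fin d) ℝ) →
    Matrix (Fin d) (Fin d) ℝ × Matrix (Fin d) (Fin N) ℝ := fun ℓ w => (w ℓ, hidden γ X w ℓ) with hG
  have hGm : ∀ ℓ, Measurable (G ℓ) := fun ℓ =>
    (measurable_pi_apply ℓ).prodMk (measurable_hidden γ X ℓ)
  refine ae_tendsto_average_of_orthogonal (Y := fun ℓ ω => ψ (G ℓ fun k => W k ω))
    (fun ℓ => (hψm.comp (hGm ℓ)).comp_aemeasurable h.aemeasurable)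
    (fun ℓ ω => hψC _) fun i j hij => ?_
  -- For `i < j`, both the increment at layer `i` and the state entering layer `j` depend only on
  -- weights before `j`, hence are jointly independent of `W j`.
  let f : (ℕ → Matrix (Fin d) (Fin d) ℝ) → ℝ × Matrix (Fin d) (Fin N) ℝ :=
    fun w => (ψ (G i w), hidden γ X w j)
  have hf : Measurable f := (hψm.comp (hGm i)).prodMk (measurable_hidden γ X j)
  have hft : ∀ w, f (truncate j w) = f w := fun w => by
    simp only [f, hG, hidden_truncate γ X w hij.le, hidden_truncate γ X w le_rfl]
    rw [truncate, if_pos hij]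
  have hind := h.indepFun_past j hf hft
  have hfm : AEMeasurable (fun ω => f fun k => W k ω) Pr := hf.comp_aemeasurable h.aemeasurable
  have hWm := (h.hasLaw j).aemeasurable
  rw [indepFun_iff_map_prod_eq_prod_map_map hfm hWm, (h.hasLaw j).map_eq] at hind
  set κ := Pr.map fun ω => f fun k => W k ω
  have hκ : IsProbabilityMeasure κ := Measure.isProbabilityMeasure_map hfm
  let F : (ℝ × Matrix (Fin d) (Fin N) ℝ) × Matrix (Fin d) (Fin d) ℝ → ℝ :=
    fun q => q.1.1 * ψ (q.2, q.1.2)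
  have hF : Measurable F := (measurable_fst.comp measurable_fst).mul
    (hψm.comp (measurable_snd.prodMk (measurable_snd.comp measurable_fst)))
  have e1 : ∫ ω, ψ (G i fun k => W k ω) * ψ (G j fun k => W k ω) ∂Pr =
      ∫ q, F q ∂(κ.prod μ) := by
    rw [← hind, integral_map (hfm.prodMk hWm) hF.aestronglyMeasurable]
  have hFi : Integrable F (κ.prod μ) := by
    rw [← hind, integrable_map_measure hF.aestronglyMeasurable (hfm.prodMk hWm)]
    refine Integrable.of_bound (hF.comp_aemeasurable (hfm.prodMk hWm)).aestronglyMeasurable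
      ((C + C) * (C + C)) (.of_forall fun ω => ?_)
    simp only [Function.comp_apply, F, f, Real.norm_eq_abs, abs_mul]
    exact mul_le_mul (hψC _) (hψC _) (abs_nonneg _) ((abs_nonneg _).trans (hψC (0, 0)))
  -- Integrating first over the fresh weights kills the product, because `ψ` is centred for every
  -- fixed state.
  rw [e1, integral_prod _ hFi]
  simp only [F, integral_const_mul, hψ0, mul_zero, integral_zero]

end LLN

end BNNet

end

noncomputable section

namespace BNNet

/-! ### Separating families of test functions -/

section Separating

instance matrixMetrizableSpace {m n : Type*} [Countable m] [Countable n] :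
    TopologicalSpace.MetrizableSpace (Matrix m n ℝ) :=
  inferInstanceAs (TopologicalSpace.MetrizableSpace (m → n → ℝ))

/-- Real and imaginary parts of the characteristic function at a dense sequence of frequencies
determine it by continuity. Countability is what matters: the law of large numbers must hold for the
whole family outside a single null set. -/
theorem exists_separating_family (E : Type*) [NormedAddCommGroup E] [NormedSpace ℝ E]
    [FiniteDimensional ℝ E] [MeasurableSpace E] [BorelSpace E] :
    ∃ g : ℕ × Bool → E →ᵇ ℝ, ∀ μ ν : Measure E, IsFiniteMeasure μ → IsFiniteMeasure ν →
      (∀ k, ∫ x, g k x ∂μ = ∫ x, g k x ∂ν) → μ = ν := by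
  have hp : ProperSpace E := FiniteDimensional.proper ℝ E
  have hpd : ProperSpace (StrongDual ℝ E) := FiniteDimensional.proper ℝ _
  have hc : CompleteSpace E := FiniteDimensional.complete ℝ E
  let L : ℕ → StrongDual ℝ E := TopologicalSpace.denseSeq (StrongDual ℝ E)
  let g : ℕ × Bool → E →ᵇ ℝ := fun k =>
    if k.2 then BoundedContinuousFunction.ofNormedAddCommGroup (fun x => Real.cos (L k.1 x))
      (by fun_prop) 1 fun x => Real.abs_cos_le_one _
    else BoundedContinuousFunction.ofNormedAddCommGroup (fun x => Real.sin (L k.1 x))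
      (by fun_prop) 1 fun x => Real.abs_sin_le_one _
  refine ⟨g, fun μ ν hμ hν h => Measure.ext_of_charFunDual ?_⟩
  have hcont : ∀ κ : Measure E, IsFiniteMeasure κ → Continuous (charFunDual κ) := fun κ _ => by
    refine continuous_of_dominated (F := fun (M : StrongDual ℝ E) x => Complex.exp (M x * Complex.I))
      (bound := fun _ => 1) (fun M => ?_) (fun M => .of_forall fun x => ?_)
      (integrable_const _) (.of_forall fun x => ?_)
    · exact Continuous.aestronglyMeasurable (by fun_prop)
    · exact (Complex.norm_exp_ofReal_mul_I _).le
    · have : Continuous fun M : StrongDual ℝ E => M x := by fun_prop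
      fun_prop
  have hval : ∀ (κ : Measure E), IsFiniteMeasure κ → ∀ k, charFunDual κ (L k) =
      ((∫ x, g (k, true) x ∂κ : ℝ) : ℂ) + ((∫ x, g (k, false) x ∂κ : ℝ) : ℂ) * Complex.I :=
    fun κ _ k => by
      rw [charFunDual_apply, ← integral_complex_ofReal, ← integral_complex_ofReal, ← integral_mul_const,
        ← integral_add]
      · refine integral_congr_ae (.of_forall fun x => ?_)
        simp only [g, if_true, Bool.false_eq_true, if_false,
          BoundedContinuousFunction.coe_ofNormedAddCommGroup, Complex.exp_mul_I]
        simp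
      · exact ((g (k, true)).integrable κ).ofReal
      · exact ((g (k, false)).integrable κ).ofReal.mul_const _
  refine Continuous.ext_on (TopologicalSpace.denseRange_denseSeq _) (hcont μ hμ) (hcont ν hν) ?_
  rintro _ ⟨k, rfl⟩
  rw [hval μ hμ k, hval ν hν k, h, h]

theorem exists_matrix_separating_family (d N : ℕ) :
    ∃ g : ℕ × Bool → Matrix (Fin d) (Fin N) ℝ →ᵇ ℝ,
      ∀ μ ν : Measure (Matrix (Fin d) (Fin N) ℝ), IsFiniteMeasure μ → IsFiniteMeasure ν →
      (∀ k, ∫ x, g k x ∂μ = ∫ x, g k x ∂ν) → μ = ν :=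
  exists_separating_family (Fin d → Fin N → ℝ)

end Separating

/-! ### Occupation limits -/

section Occupation

variable {d N : ℕ}

theorem isCompact_rowNormalized (d N : ℕ) : IsCompact (rowNormalized d N) := by
  have hcl : IsClosed (rowNormalized d N) := by
    have : rowNormalized d N = ⋂ i, {H : Matrix (Fin d) (Fin N) ℝ | ∑ j, H i j ^ 2 = N} := by
      ext H; simp [rowNormalized]
    rw [this]
    exact isClosed_iInter fun i => isClosed_eq (by fun_prop) continuous_const
  have hb : IsCompact (Set.pi Set.univ fun _ : Fin d => Set.pi Set.univ fun _ : Fin N =>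
      Set.Icc (-√(N : ℝ)) √(N : ℝ)) :=
    isCompact_univ_pi fun _ => isCompact_univ_pi fun _ => isCompact_Icc
  refine IsCompact.of_isClosed_subset (X := Matrix (Fin d) (Fin N) ℝ) hb hcl fun H hH i _ j _ => ?_
  rw [Set.mem_Icc, ← abs_le]
  refine Real.abs_le_sqrt ?_
  rw [← hH i]
  exact Finset.single_le_sum (f := fun j => H i j ^ 2) (fun j _ => sq_nonneg _)
    (Finset.mem_univ j)

/-- Clamping at a bound valid on the compact state space makes polynomial observables admissible as
test functions for weak limits. -/
theorem exists_bounded_eqOn {f : Matrix (Fin d) (Fin N) ℝ → ℝ} (hf : Continuous f) :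
    ∃ g : Matrix (Fin d) (Fin N) ℝ →ᵇ ℝ, ∀ H ∈ rowNormalized d N, g H = f H := by
  obtain ⟨C, hC⟩ := (isCompact_rowNormalized d N).exists_bound_of_continuousOn hf.continuousOn
  refine ⟨BoundedContinuousFunction.ofNormedAddCommGroup (fun H => max (-|C|) (min |C| (f H)))
    (by fun_prop) |C| fun H => ?_, fun H hH => ?_⟩
  · rw [Real.norm_eq_abs, abs_le]
    exact ⟨le_max_left _ _, max_le (by linarith [abs_nonneg C]) (min_le_left _ _)⟩
  · have := abs_le.1 ((hC H hH).trans (le_abs_self C))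
    simp [this.1, this.2]

/-- A trajectory in the compact state space has an occupation limit along the squares. -/
theorem exists_occupationLimit {h : ℕ → Matrix (Fin d) (Fin N) ℝ}
    (hh : ∀ ℓ, 1 ≤ ℓ → h ℓ ∈ rowNormalized d N) :
    ∃ s : ℕ → ℕ, StrictMono s ∧ ∃ ρ : Measure (Matrix (Fin d) (Fin N) ℝ),
      IsProbabilityMeasure ρ ∧ (∀ᵐ H ∂ρ, H ∈ rowNormalized d N) ∧
      ∀ g : Matrix (Fin d) (Fin N) ℝ →ᵇ ℝ,
        Tendsto (fun n => ((s n ^ 2 : ℕ) : ℝ)⁻¹ * ∑ ℓ ∈ Finset.Icc 1 (s n ^ 2), g (h ℓ)) atTop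
          (𝓝 (∫ H, g H ∂ρ)) := by
  let K := rowNormalized d N
  have hK : CompactSpace K := isCompact_iff_compactSpace.1 (isCompact_rowNormalized d N)
  -- The input at index `0` need not be row-normalized; its replacement never enters the averages,
  -- which start at `1`.
  let h' : ℕ → K := fun ℓ => if hℓ : 1 ≤ ℓ then ⟨h ℓ, hh ℓ hℓ⟩ else ⟨h 1, hh 1 le_rfl⟩
  have hh' : ∀ ℓ, 1 ≤ ℓ → (h' ℓ : Matrix (Fin d) (Fin N) ℝ) = h ℓ := fun ℓ hℓ => by simp [h', hℓ]
  -- The shift to `n + 1` avoids an empty average, so every `m n` is a probability measure.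
  let m : ℕ → Measure K := fun n => ∑ ℓ ∈ Finset.Icc 1 ((n + 1) ^ 2),
    (((n + 1) ^ 2 : ℕ) : ENNReal)⁻¹ • Measure.dirac (h' ℓ)
  have hm : ∀ n, IsProbabilityMeasure (m n) := fun n => ⟨by
    simp only [m, Measure.coe_finsetSum, Finset.sum_apply, Measure.smul_apply, measure_univ,
      smul_eq_mul, mul_one, Finset.sum_const, Nat.card_Icc, Nat.add_sub_cancel, nsmul_eq_mul]
    exact ENNReal.mul_inv_cancel (by simp) (by simp)⟩
  have hmi : ∀ n (g : K →ᵇ ℝ), ∫ x, g x ∂(m n) =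
      (((n + 1) ^ 2 : ℕ) : ℝ)⁻¹ * ∑ ℓ ∈ Finset.Icc 1 ((n + 1) ^ 2), g (h' ℓ) := fun n g => by
    simp only [m]
    rw [integral_finsetSum_measure fun ℓ _ =>
      ((g.integrable (Measure.dirac (h' ℓ))).smul_measure (by simp)), Finset.mul_sum]
    refine Finset.sum_congr rfl fun ℓ _ => ?_
    rw [integral_smul_measure, integral_dirac, ENNReal.toReal_inv, ENNReal.toReal_natCast,
      smul_eq_mul]
  let u : ℕ → ProbabilityMeasure K := fun n => ⟨m n, hm n⟩
  obtain ⟨ρ, φ, hφ, hlim⟩ := CompactSpace.tendsto_subseq u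
  rw [ProbabilityMeasure.tendsto_iff_forall_integral_tendsto] at hlim
  have hval : Measurable (Subtype.val : K → Matrix (Fin d) (Fin N) ℝ) := measurable_subtype_coe
  refine ⟨fun n => φ n + 1, fun a b hab => Nat.succ_lt_succ (hφ hab),
    (ρ : Measure K).map Subtype.val, Measure.isProbabilityMeasure_map hval.aemeasurable, ?_,
    fun g => ?_⟩
  · exact (ae_map_iff (p := fun H => H ∈ rowNormalized d N) hval.aemeasurable
      (isCompact_rowNormalized d N).isClosed.measurableSet).2 (.of_forall fun x => x.2)
  · have h1 := hlim (g.compContinuous ⟨Subtype.val, continuous_subtype_val⟩)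
    rw [integral_map hval.aemeasurable g.continuous.measurable.aestronglyMeasurable]
    refine h1.congr fun n => (hmi (φ n) _).trans ?_
    congr 1
    refine Finset.sum_congr rfl fun ℓ hℓ => ?_
    simp [hh' ℓ (Finset.mem_Icc.1 hℓ).1]

theorem tendsto_average_continuous {h : ℕ → Matrix (Fin d) (Fin N) ℝ}
    (hh : ∀ ℓ, 1 ≤ ℓ → h ℓ ∈ rowNormalized d N) {s : ℕ → ℕ}
    {ρ : Measure (Matrix (Fin d) (Fin N) ℝ)} (hρ : ∀ᵐ H ∂ρ, H ∈ rowNormalized d N)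
    (hlim : ∀ g : Matrix (Fin d) (Fin N) ℝ →ᵇ ℝ,
      Tendsto (fun n => ((s n ^ 2 : ℕ) : ℝ)⁻¹ * ∑ ℓ ∈ Finset.Icc 1 (s n ^ 2), g (h ℓ)) atTop
        (𝓝 (∫ H, g H ∂ρ))) {f : Matrix (Fin d) (Fin N) ℝ → ℝ} (hf : Continuous f) :
    Tendsto (fun n => ((s n ^ 2 : ℕ) : ℝ)⁻¹ * ∑ ℓ ∈ Finset.Icc 1 (s n ^ 2), f (h ℓ)) atTop
      (𝓝 (∫ H, f H ∂ρ)) := by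
  obtain ⟨g, hg⟩ := exists_bounded_eqOn hf
  have e : ∫ H, g H ∂ρ = ∫ H, f H ∂ρ := integral_congr_ae (hρ.mono hg)
  rw [← e]
  refine (hlim g).congr fun n => ?_
  congr 1
  exact Finset.sum_congr rfl fun ℓ hℓ => hg _ (hh ℓ (Finset.mem_Icc.1 hℓ).1)

/-- The layer map with row norms cut off away from zero, which makes it continuous. -/
def cutoffLayer (γ : ℝ) (W : Matrix (Fin d) (Fin d) ℝ) (H : Matrix (Fin d) (Fin N) ℝ) :
    Matrix (Fin d) (Fin N) ℝ :=
  Matrix.diagonal (fun i => (√(max (secondMoment (H + γ • (W * H)) i i) (1 / 2)))⁻¹) *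
    (H + γ • (W * H))

theorem cutoffLayer_eq {γ : ℝ} {W : Matrix (Fin d) (Fin d) ℝ} {H : Matrix (Fin d) (Fin N) ℝ}
    (h : ∀ i, 1 / 2 ≤ secondMoment (H + γ • (W * H)) i i) : cutoffLayer γ W H = layer γ W H := by
  simp only [cutoffLayer, layer, batchNorm, max_eq_left (h _)]

theorem continuous_secondMoment :
    Continuous (secondMoment : Matrix (Fin d) (Fin N) ℝ → Matrix (Fin d) (Fin d) ℝ) := by
  unfold secondMoment
  fun_prop

theorem continuous_cutoffLayer (γ : ℝ) :
    Continuous fun p : Matrix (Fin d) (Fin d) ℝ × Matrix (Fin d) (Fin N) ℝ =>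
      cutoffLayer γ p.1 p.2 := by
  have hG : Continuous fun p : Matrix (Fin d) (Fin d) ℝ × Matrix (Fin d) (Fin N) ℝ =>
      p.2 + γ • (p.1 * p.2) := by fun_prop
  have hM := continuous_secondMoment.comp hG
  refine continuous_matrix fun i j => ?_
  simp only [cutoffLayer, Matrix.diagonal_mul]
  refine Continuous.mul (Continuous.inv₀ ?_ fun p => ?_) ?_
  · exact ((hM.matrix_elem i i).max continuous_const).sqrt
  · exact (Real.sqrt_pos.2 (lt_max_of_lt_right (by norm_num))).ne'
  · exact hG.matrix_elem i j

/-- Shifting time by one changes the sum by two bounded boundary terms, which the factor `1 / L`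
removes. -/
theorem tendsto_average_shift {h : ℕ → Matrix (Fin d) (Fin N) ℝ}
    (g : Matrix (Fin d) (Fin N) ℝ →ᵇ ℝ) {L : ℕ → ℕ} (hL : Tendsto L atTop atTop) {a : ℝ}
    (ha : Tendsto (fun n => (L n : ℝ)⁻¹ * ∑ ℓ ∈ Finset.Icc 1 (L n), g (h ℓ)) atTop (𝓝 a)) :
    Tendsto (fun n => (L n : ℝ)⁻¹ * ∑ ℓ ∈ Finset.Icc 1 (L n), g (h (ℓ + 1))) atTop (𝓝 a) := by
  have h0 : Tendsto (fun n => (L n : ℝ)⁻¹ * (g (h (L n + 1)) - g (h 1))) atTop (𝓝 0) := by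
    have h1 : Tendsto (fun n => (L n : ℝ)⁻¹) atTop (𝓝 0) :=
      tendsto_inv_atTop_zero.comp (tendsto_natCast_atTop_atTop.comp hL)
    refine h1.zero_mul_isBoundedUnder_le (isBoundedUnder_of ⟨‖g‖ + ‖g‖, fun n => ?_⟩)
    exact (norm_sub_le _ _).trans (add_le_add (g.norm_coe_le_norm _) (g.norm_coe_le_norm _))
  have h2 := ha.add h0
  rw [add_zero] at h2
  refine h2.congr fun n => ?_
  rw [← mul_add]
  congr 1
  induction L n with
  | zero => simp
  | succ k ih =>
    rw [Finset.sum_Icc_succ_top (by omega), Finset.sum_Icc_succ_top (by omega), ← ih]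
    ring

/-- Krylov–Bogoliubov along one trajectory. The average of the one-step expectation of a test
function agrees in the limit with the average of its next value by `hlln`, and this with the average
of its present value by shifting time. The cutoff makes the transition operator preserve continuity
and changes nothing almost surely. -/
theorem isInvariant_of_occupationLimit {γ : ℝ} {P : Measure ℝ} {B : ℝ}
    (hμ : IsStandardLaw B (weightMatrixLaw d P))
    (hstep : ∀ (W : Matrix (Fin d) (Fin d) ℝ), (∀ i j, |W i j| ≤ B) →
      ∀ H ∈ rowNormalized d N, ∀ i, 1 / 2 ≤ secondMoment (H + γ • (W * H)) i i)
    {g : ℕ × Bool → Matrix (Fin d) (Fin N) ℝ →ᵇ ℝ}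
    (hg : ∀ μ ν : Measure (Matrix (Fin d) (Fin N) ℝ), IsFiniteMeasure μ → IsFiniteMeasure ν →
      (∀ k, ∫ x, g k x ∂μ = ∫ x, g k x ∂ν) → μ = ν)
    {w : ℕ → Matrix (Fin d) (Fin d) ℝ} {h : ℕ → Matrix (Fin d) (Fin N) ℝ}
    (hw : ∀ ℓ i j, |w ℓ i j| ≤ B) (hh : ∀ ℓ, 1 ≤ ℓ → h ℓ ∈ rowNormalized d N)
    (hrec : ∀ ℓ, h (ℓ + 1) = layer γ (w ℓ) (h ℓ))
    (hlln : ∀ k, Tendsto (fun n : ℕ => ((n ^ 2 : ℕ) : ℝ)⁻¹ * ∑ ℓ ∈ Finset.Icc 1 (n ^ 2),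
      (g k (cutoffLayer γ (w ℓ) (h ℓ)) -
        ∫ W, g k (cutoffLayer γ W (h ℓ)) ∂(weightMatrixLaw d P))) atTop (𝓝 0))
    {s : ℕ → ℕ} (hs : StrictMono s) {ρ : Measure (Matrix (Fin d) (Fin N) ℝ)}
    (hρ : IsProbabilityMeasure ρ) (hρK : ∀ᵐ H ∂ρ, H ∈ rowNormalized d N)
    (hlim : ∀ g : Matrix (Fin d) (Fin N) ℝ →ᵇ ℝ,
      Tendsto (fun n => ((s n ^ 2 : ℕ) : ℝ)⁻¹ * ∑ ℓ ∈ Finset.Icc 1 (s n ^ 2), g (h ℓ)) atTop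
        (𝓝 (∫ H, g H ∂ρ))) :
    IsInvariant γ P ρ := by
  set μ := weightMatrixLaw d P
  have hμp := hμ.isProbabilityMeasure
  have hcm : Measurable fun p : Matrix (Fin d) (Fin d) ℝ × Matrix (Fin d) (Fin N) ℝ =>
      cutoffLayer γ p.1 p.2 := (continuous_cutoffLayer γ).measurable
  have hae : ∀ᵐ p ∂(μ.prod ρ), cutoffLayer γ p.1 p.2 = layer γ p.1 p.2 := by
    have h1 : ∀ᵐ p ∂(μ.prod ρ), ∀ i j, |p.1 i j| ≤ B :=
      Measure.quasiMeasurePreserving_fst.ae hμ.bounded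
    have h2 : ∀ᵐ p ∂(μ.prod ρ), p.2 ∈ rowNormalized d N :=
      Measure.quasiMeasurePreserving_snd.ae hρK
    filter_upwards [h1, h2] with p hp1 hp2 using cutoffLayer_eq (hstep p.1 hp1 p.2 hp2)
  refine ⟨hρ, hρK, ?_⟩
  rw [← Measure.map_congr hae]
  refine hg _ _ (Measure.isFiniteMeasure_map _ _) inferInstance fun k => ?_
  rw [integral_map hcm.aemeasurable (g k).continuous.measurable.aestronglyMeasurable]
  have hgc : Continuous fun p : Matrix (Fin d) (Fin d) ℝ × Matrix (Fin d) (Fin N) ℝ =>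
      g k (cutoffLayer γ p.1 p.2) := (g k).continuous.comp (continuous_cutoffLayer γ)
  have hint : Integrable (fun p : Matrix (Fin d) (Fin d) ℝ × Matrix (Fin d) (Fin N) ℝ =>
      g k (cutoffLayer γ p.1 p.2)) (μ.prod ρ) :=
    Integrable.of_bound hgc.measurable.aestronglyMeasurable ‖g k‖
      (.of_forall fun p => (g k).norm_coe_le_norm _)
  rw [integral_prod_symm _ hint]
  -- The Feller property, by dominated convergence; it allows the one-step expectation to be tested
  -- against the weak limit.
  have hbc : Continuous fun H => ∫ W, g k (cutoffLayer γ W H) ∂μ := by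
    refine continuous_of_dominated
      (F := fun (H : Matrix (Fin d) (Fin N) ℝ) W => g k (cutoffLayer γ W H))
      (bound := fun _ => ‖g k‖) (fun H => ?_)
      (fun H => .of_forall fun W => (g k).norm_coe_le_norm _) (integrable_const _)
      (.of_forall fun W => ?_)
    · exact (measurable_pair_left hgc.measurable H).aestronglyMeasurable
    · have h1 : Continuous fun H : Matrix (Fin d) (Fin N) ℝ => (W, H) := by fun_prop
      have h2 := hgc.comp h1
      simp only [Function.comp_def] at h2
      exact h2
  have hsq : Tendsto (fun n => s n ^ 2) atTop atTop :=
    (tendsto_pow_atTop two_ne_zero).comp hs.tendsto_atTop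
  have t1 := tendsto_average_continuous hh hρK hlim hbc
  have t2 := tendsto_average_shift (g k) hsq (hlim (g k))
  have t3 := t2.sub ((hlln k).comp hs.tendsto_atTop)
  refine tendsto_nhds_unique t1 ?_
  rw [sub_zero] at t3
  refine t3.congr fun n => ?_
  simp only [Function.comp_apply]
  rw [← mul_sub, ← Finset.sum_sub_distrib]
  congr 1
  refine Finset.sum_congr rfl fun ℓ hℓ => ?_
  rw [hrec, cutoffLayer_eq (hstep _ (hw ℓ) _ (hh ℓ (Finset.mem_Icc.1 hℓ).1))]
  ring

end Occupation

end BNNet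

end

noncomputable section

namespace BNNet

/-! ### Full rank is preserved -/

section Rank

variable {d N : ℕ}

theorem posDef_secondMoment_of_rank (hN : N ≠ 0) {X : Matrix (Fin d) (Fin N) ℝ}
    (hX : X.rank = d) : (secondMoment X).PosDef := by
  have hli : LinearIndependent ℝ X.row := by
    rw [linearIndependent_iff_card_eq_finrank_span, Set.finrank, ← Matrix.rank_eq_finrank_span_row, hX,
      Fintype.card_fin]
  have h := Matrix.PosDef.mul_conjTranspose_self X (Matrix.vecMul_injective_iff.2 hli)
  rw [Matrix.conjTranspose_eq_transpose_of_trivial] at h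
  have hN' : (0 : ℝ) < N := by exact_mod_cast Nat.pos_of_ne_zero hN
  exact h.smul (inv_pos.2 hN')

theorem rank_of_posDef_secondMoment {H : Matrix (Fin d) (Fin N) ℝ}
    (h : (secondMoment H).PosDef) : H.rank = d := by
  refine le_antisymm H.rank_le_height ?_
  have h1 : (secondMoment H).rank = d := by
    rw [Matrix.rank_of_isUnit _ h.isUnit, Fintype.card_fin]
  refine h1.symm.trans_le ?_
  rw [secondMoment, ← Matrix.smul_mul]
  exact (Matrix.rank_mul_le_right _ _).trans_eq H.rank_transpose

theorem posDef_conj {M A : Matrix (Fin d) (Fin d) ℝ} (hM : M.PosDef) (hA : A.det ≠ 0) :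
    (A * M * Aᵀ).PosDef := by
  have h := hM.mul_mul_conjTranspose_same (B := A) (Matrix.vecMul_injective_of_isUnit
    ((Matrix.isUnit_iff_isUnit_det A).2 (isUnit_iff_ne_zero.2 hA)))
  rwa [Matrix.conjTranspose_eq_transpose_of_trivial] at h

variable {γ : ℝ} {W : Matrix (Fin d) (Fin d) ℝ} {H : Matrix (Fin d) (Fin N) ℝ}

theorem posDef_residualMoment (hW : (1 + γ • W).det ≠ 0) (hH : (secondMoment H).PosDef) :
    (residualMoment γ W (secondMoment H)).PosDef :=
  posDef_conj hH hW

theorem secondMoment_layer (γ : ℝ) (W : Matrix (Fin d) (Fin d) ℝ) (H : Matrix (Fin d) (Fin N) ℝ) :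
    secondMoment (layer γ W H) =
      Matrix.diagonal (fun i => (√(residualMoment γ W (secondMoment H) i i))⁻¹) *
        residualMoment γ W (secondMoment H) *
        (Matrix.diagonal fun i => (√(residualMoment γ W (secondMoment H) i i))⁻¹)ᵀ := by
  rw [layer, batchNorm, secondMoment_mul, secondMoment_residual]

theorem det_diagonal_inv_sqrt_pos (hW : (1 + γ • W).det ≠ 0) (hH : (secondMoment H).PosDef) :
    0 < (Matrix.diagonal fun i =>
      (√(residualMoment γ W (secondMoment H) i i))⁻¹ : Matrix (Fin d) (Fin d) ℝ).det := by
  rw [Matrix.det_diagonal]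
  exact Finset.prod_pos fun i _ => inv_pos.2 (Real.sqrt_pos.2 (posDef_residualMoment hW hH).diag_pos)

theorem posDef_secondMoment_layer (hW : (1 + γ • W).det ≠ 0) (hH : (secondMoment H).PosDef) :
    (secondMoment (layer γ W H)).PosDef := by
  rw [secondMoment_layer]
  exact posDef_conj (posDef_residualMoment hW hH) (det_diagonal_inv_sqrt_pos hW hH).ne'

theorem layer_mem_rowNormalized (hN : N ≠ 0) (hW : (1 + γ • W).det ≠ 0)
    (hH : (secondMoment H).PosDef) : layer γ W H ∈ rowNormalized d N := by
  rw [mem_rowNormalized_iff hN]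
  intro i
  have h := (posDef_residualMoment hW hH).diag_pos (i := i)
  rw [secondMoment_layer, Matrix.diagonal_transpose, Matrix.mul_diagonal, Matrix.diagonal_mul]
  have h1 := Real.mul_self_sqrt h.le
  have h2 := (Real.sqrt_pos.2 h).ne'
  field_simp
  rw [pow_two, h1]

/-- A layer conjugates the second moment matrix, so its determinant is multiplied by a factor, and
`log det` telescopes along the chain. -/
theorem log_det_secondMoment_layer (hW : (1 + γ • W).det ≠ 0) (hH : (secondMoment H).PosDef) :
    Real.log (secondMoment (layer γ W H)).det =
      Real.log (secondMoment H).det + logDetStep γ W (secondMoment H) := by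
  have hD := (det_diagonal_inv_sqrt_pos hW hH).ne'
  have hp := fun i => (posDef_residualMoment hW hH).diag_pos (i := i)
  have hlogD : Real.log (Matrix.diagonal fun i =>
      (√(residualMoment γ W (secondMoment H) i i))⁻¹ : Matrix (Fin d) (Fin d) ℝ).det =
      -(∑ i, Real.log (residualMoment γ W (secondMoment H) i i)) / 2 := by
    rw [Matrix.det_diagonal, Real.log_prod fun i _ =>
      (inv_pos.2 (Real.sqrt_pos.2 (hp i))).ne']
    simp only [Real.log_inv, Real.log_sqrt (hp _).le, Finset.sum_neg_distrib, ← Finset.sum_div]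
    ring
  rw [secondMoment_layer, Matrix.det_mul, Matrix.det_mul, Matrix.det_transpose,
    Real.log_mul (mul_ne_zero hD (posDef_residualMoment hW hH).det_pos.ne') hD,
    Real.log_mul hD (posDef_residualMoment hW hH).det_pos.ne', hlogD, residualMoment,
    Matrix.det_mul, Matrix.det_mul, Matrix.det_transpose,
    Real.log_mul (mul_ne_zero hW hH.det_pos.ne') hW, Real.log_mul hW hH.det_pos.ne', logDetStep]
  simp only [residualMoment]
  ring

theorem isCorrelation_secondMoment (hN : N ≠ 0) (hH : H ∈ rowNormalized d N) :
    IsCorrelation (secondMoment H) :=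
  have h := (mem_rowNormalized_iff hN H).1 hH
  ⟨secondMoment_symm H, h, abs_secondMoment_le_one h⟩

variable {X : Matrix (Fin d) (Fin N) ℝ} {w : ℕ → Matrix (Fin d) (Fin d) ℝ}

theorem posDef_secondMoment_hidden (hN : N ≠ 0) (hX : X.rank = d)
    (hw : ∀ ℓ, (1 + γ • w ℓ).det ≠ 0) (ℓ : ℕ) : (secondMoment (hidden γ X w ℓ)).PosDef := by
  induction ℓ with
  | zero => exact posDef_secondMoment_of_rank hN hX
  | succ ℓ ih => exact posDef_secondMoment_layer (hw ℓ) ih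

theorem hidden_mem_rowNormalized (hN : N ≠ 0) (hX : X.rank = d)
    (hw : ∀ ℓ, (1 + γ • w ℓ).det ≠ 0) (ℓ : ℕ) (hℓ : 1 ≤ ℓ) :
    hidden γ X w ℓ ∈ rowNormalized d N := by
  obtain ⟨k, rfl⟩ := Nat.exists_eq_add_of_le' hℓ
  exact layer_mem_rowNormalized hN (hw k) (posDef_secondMoment_hidden hN hX hw k)

end Rank

/-! ### Occupation limits stay away from rank one -/

section Limit

variable {d N : ℕ} {γ : ℝ}

theorem abs_logDetStep_le {B : ℝ}
    (hstep : (∀ W : Matrix (Fin d) (Fin d) ℝ, (∀ i j, |W i j| ≤ B) →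
        (1 + γ • W).det ∈ Set.Icc (1 / 2 : ℝ) 2) ∧
      ∀ M W : Matrix (Fin d) (Fin d) ℝ, (M, W) ∈ admissible d B →
        ∀ i, residualMoment γ W M i i ∈ Set.Icc (1 / 2 : ℝ) 2)
    {M W : Matrix (Fin d) (Fin d) ℝ} (hM : IsCorrelation M) (hW : ∀ i j, |W i j| ≤ B) :
    |logDetStep γ W M| ≤ 2 + d := by
  have h1 := abs_log_le_one (hstep.1 W hW)
  have h2 : |∑ i, Real.log (residualMoment γ W M i i)| ≤ d := by
    refine (Finset.abs_sum_le_sum_abs _ _).trans ?_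
    refine (Finset.sum_le_card_nsmul _ _ 1 fun i _ =>
      abs_log_le_one (hstep.2 M W (hM.mem_admissible hW) i)).trans ?_
    simp
  rw [logDetStep]
  refine (abs_sub _ _).trans (add_le_add ?_ h2)
  rw [abs_mul, abs_two]
  linarith

/-- `logDetStep` truncated to a bounded function of weights and hidden representation. -/
def clampedLogDetStep (γ : ℝ) (p : Matrix (Fin d) (Fin d) ℝ × Matrix (Fin d) (Fin N) ℝ) : ℝ :=
  max (-(2 + d)) (min (2 + d) (logDetStep γ p.1 (secondMoment p.2)))

theorem clampedLogDetStep_eq {p : Matrix (Fin d) (Fin d) ℝ × Matrix (Fin d) (Fin N) ℝ}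
    (h : |logDetStep γ p.1 (secondMoment p.2)| ≤ 2 + d) :
    clampedLogDetStep γ p = logDetStep γ p.1 (secondMoment p.2) := by
  rw [abs_le] at h
  rw [clampedLogDetStep, min_eq_right h.2, max_eq_right h.1]

theorem abs_clampedLogDetStep_le
    (p : Matrix (Fin d) (Fin d) ℝ × Matrix (Fin d) (Fin N) ℝ) :
    |clampedLogDetStep γ p| ≤ 2 + d := by
  have : (0 : ℝ) ≤ 2 + d := by positivity
  rw [clampedLogDetStep, abs_le]
  exact ⟨le_max_left _ _, max_le (by linarith) (min_le_left _ _)⟩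

theorem measurable_clampedLogDetStep (γ : ℝ) :
    Measurable (clampedLogDetStep γ :
      Matrix (Fin d) (Fin d) ℝ × Matrix (Fin d) (Fin N) ℝ → ℝ) := by
  have h1 : Measurable fun p : Matrix (Fin d) (Fin d) ℝ × Matrix (Fin d) (Fin N) ℝ =>
      (p.1, secondMoment p.2) :=
    measurable_fst.prodMk (continuous_secondMoment.measurable.comp measurable_snd)
  have h2 := (measurable_logDetStep (d := d) γ).comp h1
  simp only [Function.comp_def] at h2
  unfold clampedLogDetStep
  exact measurable_const.max (measurable_const.min h2)

theorem continuous_frobSq : Continuous (frobSq : Matrix (Fin d) (Fin d) ℝ → ℝ) := by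
  unfold frobSq
  fun_prop

/-- Only an upper bound is available: `log det` tends to `-∞` at singular states. One side is enough
for the drift argument. -/
theorem exists_log_det_secondMoment_le (d N : ℕ) :
    ∃ C : ℝ, ∀ H ∈ rowNormalized d N, (secondMoment H).PosDef →
      Real.log (secondMoment H).det ≤ C := by
  have hc : Continuous fun H : Matrix (Fin d) (Fin N) ℝ => (secondMoment H).det :=
    continuous_secondMoment.matrix_det
  obtain ⟨C, hC⟩ := (isCompact_rowNormalized d N).exists_bound_of_continuousOn hc.continuousOn
  refine ⟨C, fun H hH hpd => ?_⟩
  have h1 := Real.log_le_sub_one_of_pos hpd.det_pos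
  have h2 := (le_abs_self _).trans (hC H hH)
  linarith

/-- A quantity that is bounded above cannot have a positive average drift. The observed increments
of `log det` sum to at most a constant, and by `hlln` their averages agree with those of the
conditional drifts, which `hdrift` bounds from below. -/
theorem integral_frobSq_occupationLimit_le {P : Measure ℝ} {B ε : ℝ} (hN : N ≠ 0) (hγ : 0 < γ)
    (hμ : IsStandardLaw B (weightMatrixLaw d P))
    (hstep : (∀ W : Matrix (Fin d) (Fin d) ℝ, (∀ i j, |W i j| ≤ B) →
        (1 + γ • W).det ∈ Set.Icc (1 / 2 : ℝ) 2) ∧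
      ∀ M W : Matrix (Fin d) (Fin d) ℝ, (M, W) ∈ admissible d B →
        ∀ i, residualMoment γ W M i i ∈ Set.Icc (1 / 2 : ℝ) 2)
    (hdrift : ∀ M : Matrix (Fin d) (Fin d) ℝ, IsCorrelation M →
      γ ^ 2 * (2 * frobSq M - d - (d : ℝ) ^ 2 - ε) ≤
        ∫ W, logDetStep γ W M ∂(weightMatrixLaw d P))
    {X : Matrix (Fin d) (Fin N) ℝ} (hX : X.rank = d) {w : ℕ → Matrix (Fin d) (Fin d) ℝ}
    (hw : ∀ ℓ i j, |w ℓ i j| ≤ B)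
    (hlln : Tendsto (fun n : ℕ => ((n ^ 2 : ℕ) : ℝ)⁻¹ * ∑ ℓ ∈ Finset.Icc 1 (n ^ 2),
      (clampedLogDetStep γ (w ℓ, hidden γ X w ℓ) -
        ∫ W, clampedLogDetStep γ (W, hidden γ X w ℓ) ∂(weightMatrixLaw d P))) atTop (𝓝 0))
    {s : ℕ → ℕ} (hs : StrictMono s) {a : ℝ}
    (hlim : Tendsto (fun n => ((s n ^ 2 : ℕ) : ℝ)⁻¹ * ∑ ℓ ∈ Finset.Icc 1 (s n ^ 2),
      (2 * frobSq (secondMoment (hidden γ X w ℓ)) - d - (d : ℝ) ^ 2 - ε)) atTop (𝓝 a)) :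
    a ≤ 0 := by
  set μ := weightMatrixLaw d P
  have hμp := hμ.isProbabilityMeasure
  have hdet : ∀ ℓ, (1 + γ • w ℓ).det ≠ 0 := fun ℓ => by
    have := (hstep.1 (w ℓ) (hw ℓ)).1
    linarith
  set h := hidden γ X w
  have hpd := posDef_secondMoment_hidden (γ := γ) (w := w) hN hX hdet
  have hK := hidden_mem_rowNormalized (γ := γ) (w := w) hN hX hdet
  obtain ⟨C, hC⟩ := exists_log_det_secondMoment_le d N
  set V : ℕ → ℝ := fun ℓ => Real.log (secondMoment (h ℓ)).det with hV
  have hφ : ∀ ℓ, 1 ≤ ℓ → clampedLogDetStep γ (w ℓ, h ℓ) = V (ℓ + 1) - V ℓ := fun ℓ hℓ => by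
    rw [clampedLogDetStep_eq (abs_logDetStep_le hstep
      (isCorrelation_secondMoment hN (hK ℓ hℓ)) (hw ℓ))]
    have := log_det_secondMoment_layer (hdet ℓ) (hpd ℓ)
    simp only [hV]
    change _ = Real.log (secondMoment (layer γ (w ℓ) (h ℓ))).det - _
    rw [this]
    ring
  have hbar : ∀ ℓ, 1 ≤ ℓ → γ ^ 2 * (2 * frobSq (secondMoment (h ℓ)) - d - (d : ℝ) ^ 2 - ε) ≤
      ∫ W, clampedLogDetStep γ (W, h ℓ) ∂μ := fun ℓ hℓ => by
    have hcor := isCorrelation_secondMoment hN (hK ℓ hℓ)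
    have e : ∫ W, clampedLogDetStep γ (W, h ℓ) ∂μ =
        ∫ W, logDetStep γ W (secondMoment (h ℓ)) ∂μ := by
      refine integral_congr_ae ?_
      filter_upwards [hμ.bounded] with W hW
      exact clampedLogDetStep_eq (abs_logDetStep_le hstep hcor hW)
    rw [e]
    exact hdrift _ hcor
  have htel : ∀ L : ℕ, ∑ ℓ ∈ Finset.Icc 1 L, clampedLogDetStep γ (w ℓ, h ℓ) ≤ C - V 1 := by
    intro L
    have : ∑ ℓ ∈ Finset.Icc 1 L, clampedLogDetStep γ (w ℓ, h ℓ) = V (L + 1) - V 1 := by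
      induction L with
      | zero => simp
      | succ k ih =>
        rw [Finset.sum_Icc_succ_top (by omega), ih, hφ _ (by omega)]
        ring
    rw [this]
    linarith [hC _ (hK (L + 1) (by omega)) (hpd (L + 1))]
  have hsq : Tendsto (fun n => ((s n ^ 2 : ℕ) : ℝ)) atTop atTop :=
    tendsto_natCast_atTop_atTop.comp ((tendsto_pow_atTop two_ne_zero).comp hs.tendsto_atTop)
  have t0 : Tendsto (fun n => ((s n ^ 2 : ℕ) : ℝ)⁻¹ * (C - V 1)) atTop (𝓝 0) := by
    simpa using (tendsto_inv_atTop_zero.comp hsq).mul_const (C - V 1)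
  have t1 := t0.sub (hlln.comp hs.tendsto_atTop)
  have t2 := hlim.const_mul (γ ^ 2)
  have hle : γ ^ 2 * a ≤ 0 - 0 := le_of_tendsto_of_tendsto' t2 t1 fun n => by
    have hsum : γ ^ 2 * ∑ ℓ ∈ Finset.Icc 1 (s n ^ 2),
        (2 * frobSq (secondMoment (h ℓ)) - d - (d : ℝ) ^ 2 - ε) ≤
        (C - V 1) - ∑ ℓ ∈ Finset.Icc 1 (s n ^ 2), (clampedLogDetStep γ (w ℓ, h ℓ) -
          ∫ W, clampedLogDetStep γ (W, h ℓ) ∂μ) := by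
      rw [Finset.mul_sum, Finset.sum_sub_distrib]
      have := Finset.sum_le_sum fun ℓ (hℓ : ℓ ∈ Finset.Icc 1 (s n ^ 2)) =>
        hbar ℓ (Finset.mem_Icc.1 hℓ).1
      linarith [htel (s n ^ 2)]
    have := mul_le_mul_of_nonneg_left hsum (inv_nonneg.2 (Nat.cast_nonneg (α := ℝ) (s n ^ 2)))
    simp only [Function.comp_apply]
    rw [← mul_sub]
    calc _ = ((s n ^ 2 : ℕ) : ℝ)⁻¹ * (γ ^ 2 * _) := by ring
      _ ≤ _ := this
  have hγ2 : 0 < γ ^ 2 := by positivity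
  by_contra! ha
  nlinarith [mul_pos hγ2 ha]

end Limit

/-! ### Stationary identities -/

section Stationary

variable {d N : ℕ} {γ : ℝ} {P : Measure ℝ} {ν : Measure (Matrix (Fin d) (Fin N) ℝ)}

theorem IsInvariant.integrable_of_continuous (h : IsInvariant γ P ν)
    {f : Matrix (Fin d) (Fin N) ℝ → ℝ} (hf : Continuous f) : Integrable f ν := by
  have := h.isProbabilityMeasure
  obtain ⟨g, hg⟩ := exists_bounded_eqOn hf
  exact (g.integrable ν).congr (h.mem_state.mono hg)

theorem continuous_trace_cube :
    Continuous fun H : Matrix (Fin d) (Fin N) ℝ => (secondMoment H ^ 3).trace := by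
  have := continuous_secondMoment (d := d) (N := N)
  fun_prop

theorem continuous_diagSqTrace :
    Continuous fun H : Matrix (Fin d) (Fin N) ℝ => diagSqTrace (secondMoment H) := by
  have h1 := continuous_secondMoment (d := d) (N := N)
  have h2 : Continuous fun H : Matrix (Fin d) (Fin N) ℝ => secondMoment H ^ 2 := by fun_prop
  unfold diagSqTrace
  exact continuous_finsetSum _ fun i _ => (h2.matrix_elem i i).pow 2

theorem continuous_frobSq_secondMoment :
    Continuous fun H : Matrix (Fin d) (Fin N) ℝ => frobSq (secondMoment H) :=
  continuous_frobSq.comp continuous_secondMoment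

theorem frobSq_secondMoment_layer (γ : ℝ) (W : Matrix (Fin d) (Fin d) ℝ)
    (H : Matrix (Fin d) (Fin N) ℝ) :
    frobSq (secondMoment (layer γ W H)) = nextFrobSq γ W (secondMoment H) := by
  simp only [frobSq, nextFrobSq, layer, secondMoment_batchNorm_sq, secondMoment_residual]

/-- Stationarity of the squared Frobenius norm, up to the error of the expansion. -/
theorem IsInvariant.abs_drift_le (h : IsInvariant γ P ν) (hN : N ≠ 0) (hγ : 0 < γ)
    [IsProbabilityMeasure (weightMatrixLaw d P)] {ε : ℝ}
    (hdrift : ∀ M : Matrix (Fin d) (Fin d) ℝ, IsCorrelation M →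
      |∫ W, nextFrobSq γ W M ∂(weightMatrixLaw d P) - (frobSq M + γ ^ 2 *
        (2 * (d : ℝ) ^ 2 - 2 * frobSq M - 8 * (M ^ 3).trace + 8 * diagSqTrace M))| ≤
        ε * γ ^ 2) :
    |2 * (d : ℝ) ^ 2 - 2 * ∫ H, frobSq (secondMoment H) ∂ν - 8 * ∫ H, (secondMoment H ^ 3).trace ∂ν
      + 8 * ∫ H, diagSqTrace (secondMoment H) ∂ν| ≤ ε := by
  have := h.isProbabilityMeasure
  set μ := weightMatrixLaw d P
  set F : Matrix (Fin d) (Fin N) ℝ → ℝ := fun H => frobSq (secondMoment H) with hF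
  have hFc : Continuous F := continuous_frobSq_secondMoment
  have hFi : Integrable F ν := h.integrable_of_continuous hFc
  have hlm := measurable_layer (d := d) (N := N) γ
  have hnm : Measurable fun p : Matrix (Fin d) (Fin d) ℝ × Matrix (Fin d) (Fin N) ℝ =>
      nextFrobSq γ p.1 (secondMoment p.2) := by
    have h1 : Measurable fun p : Matrix (Fin d) (Fin d) ℝ × Matrix (Fin d) (Fin N) ℝ =>
        (p.1, secondMoment p.2) :=
      measurable_fst.prodMk (continuous_secondMoment.measurable.comp measurable_snd)
    have h2 := (measurable_nextFrobSq (d := d) γ).comp h1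
    simp only [Function.comp_def] at h2
    exact h2
  have hi : Integrable (fun p : Matrix (Fin d) (Fin d) ℝ × Matrix (Fin d) (Fin N) ℝ =>
      nextFrobSq γ p.1 (secondMoment p.2)) (μ.prod ν) := by
    have h1 : Integrable F ((μ.prod ν).map fun p => layer γ p.1 p.2) := by rwa [h.map_eq]
    refine (h1.comp_measurable hlm).congr (.of_forall fun p => ?_)
    simp only [Function.comp_apply, hF, frobSq_secondMoment_layer]
  -- Stationarity: the mean of `F` is unchanged by one layer.
  have hA : ∫ H, F H ∂ν = ∫ H, ∫ W, nextFrobSq γ W (secondMoment H) ∂μ ∂ν := by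
    conv_lhs => rw [← h.map_eq]
    rw [integral_map hlm.aemeasurable hFc.measurable.aestronglyMeasurable]
    simp only [hF, frobSq_secondMoment_layer]
    exact integral_prod_symm _ hi
  have hFm : HasMean ν F (∫ H, F H ∂ν) := ⟨hFi, rfl⟩
  have hTm : HasMean ν (fun H => (secondMoment H ^ 3).trace) (∫ H, (secondMoment H ^ 3).trace ∂ν) :=
    ⟨h.integrable_of_continuous continuous_trace_cube, rfl⟩
  have hSm : HasMean ν (fun H => diagSqTrace (secondMoment H))
      (∫ H, diagSqTrace (secondMoment H) ∂ν) :=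
    ⟨h.integrable_of_continuous continuous_diagSqTrace, rfl⟩
  have hp := hFm.add (((((HasMean.const (μ := ν) (2 * (d : ℝ) ^ 2)).sub (hFm.const_mul 2)).sub
    (hTm.const_mul 8)).add (hSm.const_mul 8)).const_mul (γ ^ 2))
  have hmeas : Measurable fun H => ∫ W, nextFrobSq γ W (secondMoment H) ∂μ :=
    (hnm.stronglyMeasurable.integral_prod_left' (μ := μ)).measurable
  have key := (hp.abs_integral_sub_le (c := ε * γ ^ 2) hmeas (by
    filter_upwards [h.mem_state] with H hH
    exact hdrift _ (isCorrelation_secondMoment hN hH))).2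
  rw [← hA] at key
  have hγ2 : 0 < γ ^ 2 := by positivity
  -- The mean of `F` cancels, and dividing by `γ²` leaves the integrated drift with error `ε`.
  rw [sub_add_cancel_left, abs_neg, abs_mul, abs_of_pos hγ2, mul_comm] at key
  exact le_of_mul_le_mul_right key hγ2

theorem IsInvariant.le_integral_frobSq (h : IsInvariant γ P ν) (hN : N ≠ 0) :
    (d : ℝ) ≤ ∫ H, frobSq (secondMoment H) ∂ν := by
  have := h.isProbabilityMeasure
  have h1 := integral_mono_ae (μ := ν) (integrable_const (d : ℝ))
    (h.integrable_of_continuous continuous_frobSq_secondMoment)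
    (h.mem_state.mono fun H hH => le_frobSq (isCorrelation_secondMoment hN hH).diag)
  simpa using h1

theorem IsInvariant.le_integral_diagSqTrace (h : IsInvariant γ P ν) (hN : N ≠ 0) :
    (d : ℝ) ≤ ∫ H, diagSqTrace (secondMoment H) ∂ν := by
  have := h.isProbabilityMeasure
  have h1 := integral_mono_ae (μ := ν) (integrable_const (d : ℝ))
    (h.integrable_of_continuous continuous_diagSqTrace)
    (h.mem_state.mono fun H hH => le_diagSqTrace (secondMoment_symm H)
      (isCorrelation_secondMoment hN hH).diag)
  simpa using h1

/-- Jensen's inequality through the tangent line `2aF - a² ≤ F²` at the mean `a`, combined with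
spectral Cauchy–Schwarz and `Tr M = d`. -/
theorem IsInvariant.integral_frobSq_sq_le (h : IsInvariant γ P ν) (hN : N ≠ 0) :
    (∫ H, frobSq (secondMoment H) ∂ν) ^ 2 ≤ d * ∫ H, (secondMoment H ^ 3).trace ∂ν := by
  have := h.isProbabilityMeasure
  set a := ∫ H, frobSq (secondMoment H) ∂ν
  have hFm : HasMean ν (fun H => frobSq (secondMoment H)) a :=
    ⟨h.integrable_of_continuous continuous_frobSq_secondMoment, rfl⟩
  have hl := (hFm.const_mul (2 * a)).sub (HasMean.const (μ := ν) (a ^ 2))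
  have hr : HasMean ν (fun H => (d : ℝ) * (secondMoment H ^ 3).trace) _ :=
    HasMean.const_mul d ⟨h.integrable_of_continuous continuous_trace_cube, rfl⟩
  have h1 := integral_mono_ae hl.1 hr.1 (h.mem_state.mono fun H hH => by
    have h2 := frobSq_sq_le (secondMoment_posSemidef H)
    have h3 : (secondMoment H).trace = d := by
      simp [Matrix.trace, (isCorrelation_secondMoment hN hH).diag]
    rw [h3] at h2
    have := sq_nonneg (frobSq (secondMoment H) - a)
    simp only
    linarith)
  rw [hl.2, hr.2] at h1
  linarith

theorem integral_eq_of_map_secondMoment_eq {ρ : Measure (Matrix (Fin d) (Fin N) ℝ)}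
    (h : ρ.map secondMoment = ν.map secondMoment) {f : Matrix (Fin d) (Fin d) ℝ → ℝ}
    (hf : Continuous f) : ∫ H, f (secondMoment H) ∂ρ = ∫ H, f (secondMoment H) ∂ν := by
  have hm : Measurable (secondMoment : Matrix (Fin d) (Fin N) ℝ → Matrix (Fin d) (Fin d) ℝ) :=
    continuous_secondMoment.measurable
  rw [← integral_map hm.aemeasurable hf.measurable.aestronglyMeasurable, h,
    integral_map hm.aemeasurable hf.measurable.aestronglyMeasurable]

end Stationary

/-! ### The soft rank along the chain -/

section SoftRank

/-- A sequence that is eventually at least `c` has averages whose limit is at least `c`. -/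
theorem le_limit_average {f : ℕ → ℝ} (hf : ∀ ℓ, 0 ≤ f ℓ) {c : ℝ} (hc : 0 ≤ c) {ℓ₀ : ℕ}
    (h : ∀ ℓ, ℓ₀ ≤ ℓ → c ≤ f ℓ) {L : ℕ → ℕ} (hL : Tendsto L atTop atTop) {a : ℝ}
    (ha : Tendsto (fun n => (L n : ℝ)⁻¹ * ∑ ℓ ∈ Finset.Icc 1 (L n), f ℓ) atTop (𝓝 a)) : c ≤ a := by
  -- The terms before `ℓ₀` are only known to be nonnegative; their loss is at most the constant `c *
  -- ℓ₀`, negligible after averaging.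
  have hsum : ∀ k : ℕ, c * k - c * ℓ₀ ≤ ∑ ℓ ∈ Finset.Icc 1 k, f ℓ := fun k => by
    induction k with
    | zero =>
      have : 0 ≤ c * ℓ₀ := by positivity
      simpa using this
    | succ k ih =>
      rw [Finset.sum_Icc_succ_top (by omega)]
      rcases le_or_gt ℓ₀ (k + 1) with hk | hk
      · push_cast
        linarith [h (k + 1) hk]
      · have h1 : 0 ≤ ∑ ℓ ∈ Finset.Icc 1 k, f ℓ := Finset.sum_nonneg fun ℓ _ => hf ℓ
        have h2 : ((k + 1 : ℕ) : ℝ) ≤ ℓ₀ := by exact_mod_cast hk.le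
        have := mul_le_mul_of_nonneg_left h2 hc
        linarith [hf (k + 1)]
  have hinv : Tendsto (fun n => (L n : ℝ)⁻¹) atTop (𝓝 0) :=
    tendsto_inv_atTop_zero.comp (tendsto_natCast_atTop_atTop.comp hL)
  have t : Tendsto (fun n => c - (L n : ℝ)⁻¹ * (c * ℓ₀)) atTop (𝓝 (c - 0 * (c * ℓ₀))) :=
    tendsto_const_nhds.sub (hinv.mul_const _)
  rw [zero_mul, sub_zero] at t
  refine le_of_tendsto_of_tendsto t ha ?_
  filter_upwards [hL.eventually_ge_atTop 1] with n hn
  have hpos : (0 : ℝ) < L n := by exact_mod_cast hn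
  have := mul_le_mul_of_nonneg_left (hsum (L n)) (inv_nonneg.2 hpos.le)
  calc c - (L n : ℝ)⁻¹ * (c * ℓ₀) = (L n : ℝ)⁻¹ * (c * L n - c * ℓ₀) := by
        field_simp
    _ ≤ _ := this

end SoftRank

/-! ### Main estimates -/

section Main

variable {d N : ℕ} {γ B : ℝ} {P : Measure ℝ}

theorem frobSq_nonneg (M : Matrix (Fin d) (Fin d) ℝ) : 0 ≤ frobSq M :=
  Finset.sum_nonneg fun _ _ => Finset.sum_nonneg fun _ _ => sq_nonneg _

theorem regularityConstant_eq (ν : Measure (Matrix (Fin d) (Fin N) ℝ)) :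
    regularityConstant ν = (∫ H, diagSqTrace (secondMoment H) ∂ν) /
      ∫ H, (secondMoment H ^ 3).trace ∂ν := by
  simp only [regularityConstant, trace_diagonal_diag_sq]

/-- The law of large numbers for a bounded continuous observable of the next layer. -/
theorem IsIIDWeights.ae_tendsto_average_cutoffLayer {Ω : Type*} [MeasurableSpace Ω]
    {Pr : Measure Ω} [IsProbabilityMeasure Pr] [IsProbabilityMeasure P]
    {W : ℕ → Ω → Matrix (Fin d) (Fin d) ℝ} (hW : IsIIDWeights Pr P W) (γ : ℝ)
    (X : Matrix (Fin d) (Fin N) ℝ) (g : Matrix (Fin d) (Fin N) ℝ →ᵇ ℝ) :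
    ∀ᵐ ω ∂Pr, Tendsto (fun n : ℕ => ((n ^ 2 : ℕ) : ℝ)⁻¹ *
      ∑ ℓ ∈ Finset.Icc 1 (n ^ 2), (g (cutoffLayer γ (W ℓ ω) (hidden γ X (fun k => W k ω) ℓ)) -
        ∫ w, g (cutoffLayer γ w (hidden γ X (fun k => W k ω) ℓ)) ∂(weightMatrixLaw d P)))
      atTop (𝓝 0) := by
  have hc : Measurable fun p : Matrix (Fin d) (Fin d) ℝ × Matrix (Fin d) (Fin N) ℝ =>
      cutoffLayer γ p.1 p.2 := (continuous_cutoffLayer γ).measurable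
  have h := hW.ae_tendsto_average γ X (g.continuous.measurable.comp hc) (C := ‖g‖)
    fun p => g.norm_coe_le_norm _
  simp only [Function.comp_apply] at h
  exact h

/-- A trajectory along which the laws of large numbers hold has an invariant occupation limit of
small mean Frobenius norm. -/
theorem exists_invariant_occupationLimit (hμ : IsStandardLaw B (weightMatrixLaw d P))
    (hN : N ≠ 0) (hγ : 0 < γ) {ε : ℝ}
    (hstep : (∀ W : Matrix (Fin d) (Fin d) ℝ, (∀ i j, |W i j| ≤ B) →
        (1 + γ • W).det ∈ Set.Icc (1 / 2 : ℝ) 2) ∧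
      ∀ M W : Matrix (Fin d) (Fin d) ℝ, (M, W) ∈ admissible d B →
        ∀ i, residualMoment γ W M i i ∈ Set.Icc (1 / 2 : ℝ) 2)
    (hdrift : ∀ M : Matrix (Fin d) (Fin d) ℝ, IsCorrelation M →
      γ ^ 2 * (2 * frobSq M - d - (d : ℝ) ^ 2 - ε) ≤
        ∫ W, logDetStep γ W M ∂(weightMatrixLaw d P))
    {X : Matrix (Fin d) (Fin N) ℝ} (hX : X.rank = d)
    {g : ℕ × Bool → Matrix (Fin d) (Fin N) ℝ →ᵇ ℝ}
    (hg : ∀ μ ν : Measure (Matrix (Fin d) (Fin N) ℝ), IsFiniteMeasure μ → IsFiniteMeasure ν →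
      (∀ k, ∫ x, g k x ∂μ = ∫ x, g k x ∂ν) → μ = ν)
    {w : ℕ → Matrix (Fin d) (Fin d) ℝ} (hb : ∀ ℓ i j, |w ℓ i j| ≤ B)
    (h1 : ∀ k, Tendsto (fun n : ℕ => ((n ^ 2 : ℕ) : ℝ)⁻¹ *
      ∑ ℓ ∈ Finset.Icc 1 (n ^ 2), (g k (cutoffLayer γ (w ℓ) (hidden γ X w ℓ)) -
        ∫ v, g k (cutoffLayer γ v (hidden γ X w ℓ)) ∂(weightMatrixLaw d P)))
      atTop (𝓝 0))
    (h2 : Tendsto (fun n : ℕ => ((n ^ 2 : ℕ) : ℝ)⁻¹ * ∑ ℓ ∈ Finset.Icc 1 (n ^ 2),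
      (clampedLogDetStep γ (w ℓ, hidden γ X w ℓ) -
        ∫ v, clampedLogDetStep γ (v, hidden γ X w ℓ) ∂(weightMatrixLaw d P))) atTop (𝓝 0)) :
    ∃ s : ℕ → ℕ, StrictMono s ∧ ∃ ρ : Measure (Matrix (Fin d) (Fin N) ℝ),
      IsInvariant γ P ρ ∧ IsOccupationLimit (hidden γ X w) ρ ∧
      Tendsto (fun n => ((s n ^ 2 : ℕ) : ℝ)⁻¹ * ∑ ℓ ∈ Finset.Icc 1 (s n ^ 2),
        frobSq (secondMoment (hidden γ X w ℓ))) atTop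
        (𝓝 (∫ H, frobSq (secondMoment H) ∂ρ)) ∧
      2 * ∫ H, frobSq (secondMoment H) ∂ρ ≤ d + (d : ℝ) ^ 2 + ε := by
  have hdet : ∀ ℓ, (1 + γ • w ℓ).det ≠ 0 := fun ℓ => by
    have := (hstep.1 (w ℓ) (hb ℓ)).1
    linarith
  have hK := hidden_mem_rowNormalized (γ := γ) (w := w) hN hX hdet
  obtain ⟨s, hs, ρ, hρ, hρK, hlim⟩ := exists_occupationLimit hK
  have hinv : IsInvariant γ P ρ := by
    have hlow : ∀ w : Matrix (Fin d) (Fin d) ℝ, (∀ i j, |w i j| ≤ B) →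
        ∀ H ∈ rowNormalized d N, ∀ i, 1 / 2 ≤ secondMoment (H + γ • (w * H)) i i := by
      intro w hw H hH i
      rw [secondMoment_residual]
      exact (hstep.2 _ _ ((isCorrelation_secondMoment hN hH).mem_admissible hw) i).1
    have hrec : ∀ ℓ, hidden γ X w (ℓ + 1) =
        layer γ (w ℓ) (hidden γ X w ℓ) := fun ℓ => by rw [hidden]
    exact isInvariant_of_occupationLimit (w := w)
      (h := hidden γ X w) hμ hlow hg hb hK hrec h1 hs hρ hρK hlim
  have hF := tendsto_average_continuous hK hρK hlim continuous_frobSq_secondMoment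
  have hsq : StrictMono fun n => s n ^ 2 := fun a b hab => by
    have := hs hab
    dsimp only
    gcongr
  have hocc : IsOccupationLimit (hidden γ X w) ρ := ⟨fun n => s n ^ 2, hsq, hlim⟩
  have hc : Continuous fun H : Matrix (Fin d) (Fin N) ℝ =>
      2 * frobSq (secondMoment H) - d - (d : ℝ) ^ 2 - ε :=
    (((continuous_frobSq_secondMoment.const_mul 2).sub continuous_const).sub
      continuous_const).sub continuous_const
  have hlimc := tendsto_average_continuous hK hρK hlim hc
  have h3 := integral_frobSq_occupationLimit_le hN hγ hμ hstep hdrift hX hb h2 hs hlimc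
  have hint := hinv.integrable_of_continuous continuous_frobSq_secondMoment
  have h4 : ∫ H, (2 * frobSq (secondMoment H) - d - (d : ℝ) ^ 2 - ε) ∂ρ =
      2 * ∫ H, frobSq (secondMoment H) ∂ρ - d - (d : ℝ) ^ 2 - ε := by
    have i1 : Integrable (fun H => 2 * frobSq (secondMoment H) - d) ρ :=
      (hint.const_mul 2).sub (integrable_const _)
    have i2 : Integrable (fun H => 2 * frobSq (secondMoment H) - d - (d : ℝ) ^ 2) ρ :=
      i1.sub (integrable_const _)
    rw [integral_sub i2 (integrable_const _), integral_sub i1 (integrable_const _),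
      integral_sub (hint.const_mul 2) (integrable_const _), integral_const_mul]
    simp
  have h5 : 2 * ∫ H, frobSq (secondMoment H) ∂ρ ≤ d + (d : ℝ) ^ 2 + ε := by
    rw [h4] at h3
    linarith
  exact ⟨s, hs, ρ, hinv, hocc, hF, h5⟩

/-- Almost every trajectory has an invariant occupation limit of small mean Frobenius norm. -/
theorem IsIIDWeights.ae_exists_occupationLimit {Ω : Type*} [MeasurableSpace Ω] {Pr : Measure Ω}
    [IsProbabilityMeasure Pr] {W : ℕ → Ω → Matrix (Fin d) (Fin d) ℝ} (hP : IsWeightLaw B P)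
    (hW : IsIIDWeights Pr P W) (hN : N ≠ 0) (hγ : 0 < γ) {ε : ℝ}
    (hstep : (∀ W : Matrix (Fin d) (Fin d) ℝ, (∀ i j, |W i j| ≤ B) →
        (1 + γ • W).det ∈ Set.Icc (1 / 2 : ℝ) 2) ∧
      ∀ M W : Matrix (Fin d) (Fin d) ℝ, (M, W) ∈ admissible d B →
        ∀ i, residualMoment γ W M i i ∈ Set.Icc (1 / 2 : ℝ) 2)
    (hdrift : ∀ M : Matrix (Fin d) (Fin d) ℝ, IsCorrelation M →
      γ ^ 2 * (2 * frobSq M - d - (d : ℝ) ^ 2 - ε) ≤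
        ∫ W, logDetStep γ W M ∂(weightMatrixLaw d P))
    {X : Matrix (Fin d) (Fin N) ℝ} (hX : X.rank = d) :
    ∀ᵐ ω ∂Pr, ∃ s : ℕ → ℕ, StrictMono s ∧ ∃ ρ : Measure (Matrix (Fin d) (Fin N) ℝ),
      IsInvariant γ P ρ ∧ IsOccupationLimit (hidden γ X fun k => W k ω) ρ ∧
      Tendsto (fun n => ((s n ^ 2 : ℕ) : ℝ)⁻¹ * ∑ ℓ ∈ Finset.Icc 1 (s n ^ 2),
        frobSq (secondMoment (hidden γ X (fun k => W k ω) ℓ))) atTop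
        (𝓝 (∫ H, frobSq (secondMoment H) ∂ρ)) ∧
      2 * ∫ H, frobSq (secondMoment H) ∂ρ ≤ d + (d : ℝ) ^ 2 + ε := by
  have hPp := hP.isProbabilityMeasure
  obtain ⟨g, hg⟩ := exists_matrix_separating_family d N
  have l1 := ae_all_iff.2 fun k => hW.ae_tendsto_average_cutoffLayer γ X (g k)
  have l2 := hW.ae_tendsto_average γ X (measurable_clampedLogDetStep γ) abs_clampedLogDetStep_le
  filter_upwards [hW.ae_bounded hP, l1, l2] with ω hb h1 h2
  exact exists_invariant_occupationLimit (hW.isStandardLaw hP) hN hγ hstep hdrift hX hg hb h1 h2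

/-- Bounds on the stationary moments give the soft rank bound. -/
theorem sqrt_mul_le_of_moments {d A T S r τ : ℝ} (hd : 1 ≤ d) (hA : d ≤ A) (hT : A ^ 2 ≤ d * T)
    (hS : 4 * (T - S) ≤ d ^ 2) (hr : ((1 - τ) * d) ^ 2 ≤ r * A) :
    √(1 - S / T) * ((1 - τ) ^ 2 * √d) ≤ r := by
  have hA0 : 0 < A := by linarith
  have hT0 : 0 < T := by
    by_contra! hT0
    nlinarith [mul_nonneg (by linarith : (0 : ℝ) ≤ d) (neg_nonneg.2 hT0), pow_pos hA0 2]
  have hr0 : 0 ≤ r := by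
    by_contra! h
    nlinarith [mul_pos (neg_pos.2 h) hA0, sq_nonneg ((1 - τ) * d)]
  -- The real square root of a nonpositive number is zero, so this case asks only for `r ≥ 0`.
  rcases le_or_gt (1 - S / T) 0 with hα | hα
  · rw [Real.sqrt_eq_zero_of_nonpos hα, zero_mul]
    exact hr0
  have h1 : (1 - S / T) * A ^ 2 ≤ d * d ^ 2 := by
    have h2 : (1 - S / T) * T = T - S := by field_simp
    calc (1 - S / T) * A ^ 2 ≤ (1 - S / T) * (d * T) := mul_le_mul_of_nonneg_left hT hα.le
      _ = d * (T - S) := by rw [← h2]; ring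
      _ ≤ d * d ^ 2 := by
        refine mul_le_mul_of_nonneg_left ?_ (by linarith)
        nlinarith [sq_nonneg d]
  have h2 : √(1 - S / T) * A ≤ √d * d := by
    have := Real.sqrt_le_sqrt h1
    rwa [Real.sqrt_mul hα.le, Real.sqrt_mul (by linarith), Real.sqrt_sq hA0.le,
      Real.sqrt_sq (by linarith)] at this
  refine le_of_mul_le_mul_right ?_ hA0
  calc √(1 - S / T) * ((1 - τ) ^ 2 * √d) * A
      = (√(1 - S / T) * A) * ((1 - τ) ^ 2 * √d) := by ring
    _ ≤ (√d * d) * ((1 - τ) ^ 2 * √d) := by gcongr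
    _ = (1 - τ) ^ 2 * d * (√d * √d) := by ring
    _ = ((1 - τ) * d) ^ 2 := by rw [Real.mul_self_sqrt (by linarith)]; ring
    _ ≤ r * A := hr

end Main

end BNNet

end

/-! ### Assembly of the main theorem -/

theorem mainTheorem3 :
    ∃ c : ℝ, 0 < c ∧ ∀ (d : ℕ) (B : ℝ), ∃ γ₀ : ℝ, 0 < γ₀ ∧
      ∀ γ : ℝ, 0 < γ → γ < γ₀ →
      ∀ (N : ℕ) (X : Matrix (Fin d) (Fin N) ℝ), X.rank = d →
      ∀ P : Measure ℝ, BNNet.IsWeightLaw B P →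
      ∀ (Ω : Type*) [MeasurableSpace Ω] (Pr : Measure Ω) [IsProbabilityMeasure Pr]
        (W : ℕ → Ω → Matrix (Fin d) (Fin d) ℝ), BNNet.IsIIDWeights Pr P W →
      ∀ H : ℕ → Ω → Matrix (Fin d) (Fin N) ℝ,
        (∀ ℓ ω, H ℓ ω = BNNet.hidden γ X (fun k => W k ω) ℓ) →
      (∀ᵐ ω ∂Pr, ∀ ℓ, c * √(d : ℝ) ≤ ((H ℓ ω).rank : ℝ)) ∧
      ∀ ν : Measure (Matrix (Fin d) (Fin N) ℝ), BNNet.IsUniqueInvariant Pr γ P H ν →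
        (2 ≤ d → 0 < BNNet.regularityConstant ν ∧ BNNet.regularityConstant ν < 1) ∧
        ∀ᵐ ω ∂Pr, ∀ τ ∈ Set.Icc (0 : ℝ) 1,
          AntitoneOn (fun ℓ => BNNet.softRank τ (H ℓ ω)) (Set.Ici 1) →
          ∀ ℓ, 1 ≤ ℓ →
            √(1 - BNNet.regularityConstant ν) * ((1 - τ) ^ 2 * √(d : ℝ)) ≤
              (BNNet.softRank τ (H ℓ ω) : ℝ) := by
  -- The rank is in fact `d`, and `d ≥ √d` for `d ≥ 1`, so the constant can be one.
  refine ⟨1, one_pos, fun d B => ?_⟩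
  rcases Nat.eq_zero_or_pos d with rfl | hd
  · refine ⟨1, one_pos, fun γ _ _ N X _ P _ Ω _ Pr _ W _ H _ => ⟨.of_forall fun ω ℓ => by simp,
      fun ν _ => ⟨fun h => absurd h (by norm_num), .of_forall fun ω τ _ _ ℓ _ => by simp⟩⟩⟩
  -- Both errors equal to `1/2` suffice already at `d = 2`: the two drifts together give `8(T - S) ≥
  -- d² - d - 1`, which is then positive.
  obtain ⟨γ₁, h1, hfrob⟩ := BNNet.abs_integral_nextFrobSq_sub_le d B (ε := 1 / 2) (by norm_num)
  obtain ⟨γ₂, h2, hlog⟩ := BNNet.le_integral_logDetStep d B (ε := 1 / 2) (by norm_num)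
  obtain ⟨γ₃, h3, hstep⟩ := BNNet.exists_step_bounds d B
  refine ⟨min γ₁ (min γ₂ γ₃), lt_min h1 (lt_min h2 h3), ?_⟩
  intro γ hγ hγ' N X hX P hP Ω _ Pr _ W hW H hH
  have hγ1 : γ < γ₁ := hγ'.trans_le (min_le_left _ _)
  have hγ2 : γ < γ₂ := hγ'.trans_le ((min_le_right _ _).trans (min_le_left _ _))
  have hγ3 : γ < γ₃ := hγ'.trans_le ((min_le_right _ _).trans (min_le_right _ _))
  replace hstep := hstep γ hγ hγ3
  obtain rfl : H = fun ℓ ω => BNNet.hidden γ X (fun k => W k ω) ℓ :=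
    funext fun ℓ => funext fun ω => hH ℓ ω
  -- Rank `d ≥ 1` forces at least one column.
  have hN : N ≠ 0 := fun h => by
    have := X.rank_le_width
    omega
  have hd1 : (1 : ℝ) ≤ d := by exact_mod_cast hd
  have hPp := hP.isProbabilityMeasure
  have hμ := hW.isStandardLaw hP
  have hμp := hμ.isProbabilityMeasure
  have hdet : ∀ᵐ ω ∂Pr, ∀ ℓ, (1 + γ • W ℓ ω).det ≠ 0 := by
    filter_upwards [hW.ae_bounded hP] with ω hb ℓ
    have := (hstep.1 (W ℓ ω) (hb ℓ)).1
    linarith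
  refine ⟨?_, fun ν hν => ?_⟩
  · filter_upwards [hdet] with ω hω ℓ
    rw [BNNet.rank_of_posDef_secondMoment (BNNet.posDef_secondMoment_hidden hN hX hω ℓ), one_mul]
    refine Real.sqrt_le_iff.2 ⟨by positivity, ?_⟩
    nlinarith
  have hinv := hν.invariant
  have hdr := abs_le.1 (hinv.abs_drift_le hN hγ fun M hM => hfrob γ hγ hγ1 M hM _ hμ)
  have hA := hinv.le_integral_frobSq hN
  have hS := hinv.le_integral_diagSqTrace hN
  have hT := hinv.integral_frobSq_sq_le hN
  have hex := hW.ae_exists_occupationLimit hP hN hγ hstep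
    (fun M hM => hlog γ hγ hγ2 M hM _ hμ) hX
  rw [BNNet.regularityConstant_eq]
  set A := ∫ H, BNNet.frobSq (BNNet.secondMoment H) ∂ν
  set T := ∫ H, (BNNet.secondMoment H ^ 3).trace ∂ν
  set S := ∫ H, BNNet.diagSqTrace (BNNet.secondMoment H) ∂ν
  refine ⟨fun hd2 => ?_, ?_⟩
  -- The regularity constant is deterministic, so one good trajectory is enough to transfer the
  -- bound on `A` to `ν`.
  · obtain ⟨ω, ⟨s, -, ρ, hρ, hocc, -, hle⟩, huniq⟩ := (hex.and hν.unique).exists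
    rw [BNNet.integral_eq_of_map_secondMoment_eq (huniq ρ hρ hocc) BNNet.continuous_frobSq] at hle
    change 2 * A ≤ _ at hle
    have hd2' : (2 : ℝ) ≤ d := by exact_mod_cast hd2
    have hST : S < T := by nlinarith [hdr.2]
    have hS0 : 0 < S := by linarith
    exact ⟨div_pos hS0 (hS0.trans hST), (div_lt_one (hS0.trans hST)).2 hST⟩
  · filter_upwards [hex, hν.unique, hdet] with ω hω huniq hω' τ hτ hanti ℓ hℓ
    obtain ⟨s, hs, ρ, hρ, hocc, hlim, -⟩ := hω
    rw [BNNet.integral_eq_of_map_secondMoment_eq (huniq ρ hρ hocc) BNNet.continuous_frobSq] at hlim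
    refine BNNet.sqrt_mul_le_of_moments hd1 hA hT (by linarith [hdr.1]) ?_
    have hlim' := hlim.const_mul
      (BNNet.softRank τ (BNNet.hidden γ X (fun k => W k ω) ℓ) : ℝ)
    -- The soft rank is frozen at layer `ℓ`. By monotonicity it dominates all later soft ranks, so
    -- the pointwise bound holds from `ℓ` on and its average tends to `rank_τ · A`.
    refine BNNet.le_limit_average (ℓ₀ := ℓ) (f := fun k =>
      (BNNet.softRank τ (BNNet.hidden γ X (fun k => W k ω) ℓ) : ℝ) *
        BNNet.frobSq (BNNet.secondMoment (BNNet.hidden γ X (fun k => W k ω) k)))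
      (fun k => mul_nonneg (Nat.cast_nonneg _) (BNNet.frobSq_nonneg _)) (sq_nonneg _)
      (fun k hk => ?_) (L := fun n => s n ^ 2)
      ((tendsto_pow_atTop two_ne_zero).comp hs.tendsto_atTop) (hlim'.congr fun n => ?_)
    · have hk1 : 1 ≤ k := hℓ.trans hk
      refine (BNNet.le_softRank_mul_frobSq hN
        (BNNet.hidden_mem_rowNormalized hN hX hω' k hk1) hτ).trans ?_
      refine mul_le_mul_of_nonneg_right ?_ (BNNet.frobSq_nonneg _)
      exact_mod_cast hanti (Set.mem_Ici.2 hℓ) (Set.mem_Ici.2 hk1) hk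
    · rw [← Finset.mul_sum]
      ring
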